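/- Let $(M,g)$ be a smooth Riemannian manifold of dimension $n$ with Levi-Civita connection $\nabla$ and curvature $R(X,Y)Z=\nabla_X\nabla_YZ-\nabla_Y\nabla_XZ-\nabla_{[X,Y]}Z$, and let $f\in C^\infty(M)$, $f>0$. Let $\pi:T^*M\to M$ be the cotangent bundle, with the coordinates $(x^i,p_i)$ induced by coordinates $(x^i)$ of $M$. For a vector field $X=X^i\partial/\partial x^i$ and a 1-form $\omega=\omega_i\,dx^i$ on $M$, the horizontal and vertical lifts are the vector fields on $T^*M$ $$ {}^HX=X^i\frac{\partial}{\partial x^i}+p_h\Gamma^h_{ij}X^j\frac{\partial}{\partial p_i},\qquad {}^V\omega=\omega_i\frac{\partial}{\partial p_i}, $$ where $\Gamma^h_{ij}$ are the Christoffel symbols of $\nabla$; horizontal and vertical lifts of tangent vectors and covectors at a point are defined by the same formulas. Let $\gamma\delta=p_i\,\partial/\partial p_i$ be the Liouville vector field, $g^{-1}(\omega,\theta)=g^{ij}\omega_i\theta_j$, and $\alpha=1+g^{-1}(p,p)$. The rescaled Riemannian metric of Cheeger–Gromoll type ${}^{CG}g_f$ on $T^*M$ is defined by $$ {}^{CG}g_f({}^V\omega,{}^V\theta)=\tfrac1\alpha\big(g^{-1}(\omega,\theta)+g^{-1}(\omega,p)g^{-1}(\theta,p)\big),\quad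 {}^{CG}g_f({}^V\omega,{}^HY)=0,\quad {}^{CG}g_f({}^HX,{}^HY)=f\,g(X,Y). $$ Let $\widetilde\nabla$ be its Levi-Civita connection, and let $J$ be the almost product structure on $T^*M$ with $J({}^HX)=-{}^HX$ and $J({}^V\omega)={}^V\omega$. For vector fields $\widetilde X,\widetilde Y$ on $T^*M$ put $$ \widetilde S(\widetilde X,\widetilde Y)=\tfrac12\big\{(\widetilde\nabla_{J\widetilde Y}J)\widetilde X+J\big((\widetilde\nabla_{\widetilde Y}J)\widetilde X\big)-J\big((\widetilde\nabla_{\widetilde X}J)\widetilde Y\big)\big\},\qquad \overline\nabla_{\widetilde X}\widetilde Y=\widetilde\nabla_{\widetilde X}\widetilde Y-\widetilde S(\widetilde X,\widetilde Y). $$ Then $\overline\nabla J=0$, and for all smooth vector fields $X,Y$ and smooth 1-forms $\omega,\theta$ on $M$: 1. $\overline\nabla_{{}^HX}{}^HY={}^H(\nabla_XY)+{}^H({}^fA(X,Y))$, where ${}^fA(X,Y)=\frac1{2f}\big(X(f)\,Y+Y(f)\,X-g(X,Y)\,\mathrm{grad}_g f\big)$; 2. $\overline\nabla_{{}^HX}{}^V\theta={}^V(\nabla_X\theta)$;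 3. $\overline\nabla_{{}^V\omega}{}^HY=\frac{3}{2f\alpha}\,{}^H\big(p(g^{-1}\circ R(\cdot,Y)\tilde\omega)\big)$, where $\tilde\omega=g^{-1}\circ\omega$ is the vector field with $g(\tilde\omega,\cdot)=\omega$, and at a point $p\in T^*_xM$ the vector $p(g^{-1}\circ R(\cdot,Y)\tilde\omega)\in T_xM$ is $g^{-1}\circ\eta$ for the covector $\eta(Z)=p(R(Z,Y)\tilde\omega)$; 4. $\overline\nabla_{{}^V\omega}{}^V\theta=-\frac1\alpha\big({}^{CG}g_f({}^V\omega,\gamma\delta)\,{}^V\theta+{}^{CG}g_f({}^V\theta,\gamma\delta)\,{}^V\omega\big)+\frac{\alpha+1}{\alpha}\,{}^{CG}g_f({}^V\omega,{}^V\theta)\,\gamma\delta-\frac1\alpha\,{}^{CG}g_f({}^V\omega,\gamma\delta)\,{}^{CG}g_f({}^V\theta,\gamma\delta)\,\gamma\delta$. -/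

import Mathlib

open Bundle NormedSpace
open scoped Manifold ContDiff Topology

set_option linter.unusedSectionVars false

noncomputable section

namespace CheegerGromoll

/-! ### Connections on the tangent bundle of a manifold `N` -/

section General

variable {E : Type*} [NormedAddCommGroup E] [NormedSpace ℝ E] [FiniteDimensional ℝ E]
  {H : Type*} [TopologicalSpace H] {I : ModelWithCorners ℝ E H}
  {N : Type*} [TopologicalSpace N] [ChartedSpace H N] [IsManifold I ∞ N]

/-- `D` is the Levi-Civita connection `∇` of the metric `G` on `N`: a smooth, torsion-free
connection with `v (G (Y, Z)) = G (∇_v Y, Z) + G (Y, ∇_v Z)` for all tangent vectors `v`.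
Mathlib writes `D Y x v` for `(∇_v Y) (x)`. -/
structure IsLeviCivita (G : ∀ x : N, TangentSpace I x → TangentSpace I x → ℝ)
    (D : CovariantDerivative I E (TangentSpace I : N → Type _)) : Prop where
  smooth : D.ContMDiffCovariantDerivative ∞
  torsion_free : D.torsion = 0
  metric : ∀ (Y Z : ∀ x : N, TangentSpace I x) (x : N),
    MDiffAt (T% Y) x → MDiffAt (T% Z) x → ∀ v : TangentSpace I x,
      d% (fun y ↦ G y (Y y) (Z y)) x v = G x (D Y x v) (Z x) + G x (Y x) (D Z x v)

/-- The vector field `∇_X Y`. -/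
def nabla (D : CovariantDerivative I E (TangentSpace I : N → Type _))
    (X Y : ∀ x : N, TangentSpace I x) (x : N) : TangentSpace I x :=
  D Y x (X x)

/-- The curvature `R(X, Y) Z = ∇_X ∇_Y Z - ∇_Y ∇_X Z - ∇_[X, Y] Z`. -/
def curvature (D : CovariantDerivative I E (TangentSpace I : N → Type _))
    (X Y Z : ∀ x : N, TangentSpace I x) (x : N) : TangentSpace I x :=
  nabla D X (nabla D Y Z) x - nabla D Y (nabla D X Z) x
    - nabla D (VectorField.mlieBracket I X Y) Z x

/-- The vector field `J X`, for a field `J` of endomorphisms of the tangent spaces. -/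
def appField (J : ∀ x : N, TangentSpace I x → TangentSpace I x)
    (X : ∀ x : N, TangentSpace I x) (x : N) : TangentSpace I x :=
  J x (X x)

/-- `(∇_X J) Y = ∇_X (J Y) - J (∇_X Y)`, where `conn X Y` stands for `∇_X Y`. -/
def covEnd
    (conn : (∀ x : N, TangentSpace I x) → (∀ x : N, TangentSpace I x) → ∀ x : N, TangentSpace I x)
    (J : ∀ x : N, TangentSpace I x → TangentSpace I x)
    (X Y : ∀ x : N, TangentSpace I x) (x : N) : TangentSpace I x :=
  conn X (appField J Y) x - J x (conn X Y x)

/-- `S(X, Y) = ½ {(∇_{JY} J) X + J ((∇_Y J) X) - J ((∇_X J) Y)}`. -/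
def productTensor (D : CovariantDerivative I E (TangentSpace I : N → Type _))
    (J : ∀ x : N, TangentSpace I x → TangentSpace I x)
    (X Y : ∀ x : N, TangentSpace I x) (x : N) : TangentSpace I x :=
  (1 / 2 : ℝ) • (covEnd (nabla D) J (appField J Y) X x
    + J x (covEnd (nabla D) J Y X x) - J x (covEnd (nabla D) J X Y x))

/-- The almost product connection `∇_X Y - S(X, Y)` constructed from `∇` and `J`. -/
def productConnection (D : CovariantDerivative I E (TangentSpace I : N → Type _))
    (J : ∀ x : N, TangentSpace I x → TangentSpace I x)
    (X Y : ∀ x : N, TangentSpace I x) (x : N) : TangentSpace I x :=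
  nabla D X Y x - productTensor D J X Y x

end General

/-! ### The base manifold -/

section Base

variable {E : Type*} [NormedAddCommGroup E] [NormedSpace ℝ E] [FiniteDimensional ℝ E]
  {M : Type*} [TopologicalSpace M] [ChartedSpace E M] [IsManifold 𝓘(ℝ, E) ∞ M]

/-- The coordinate vector field `∂_i` of the preferred chart at `x`, on the domain of that chart. -/
def coordField (x : M) (i : Fin (Module.finrank ℝ E)) (y : M) : TangentSpace 𝓘(ℝ, E) y :=
  FiberBundle.extend E (show TangentSpace 𝓘(ℝ, E) x from Module.finBasis ℝ E i) y

/-- The coordinate covector `dx^i` at `x`, for the preferred chart at `x`. -/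
def coordForm (x : M) (i : Fin (Module.finrank ℝ E)) : TangentSpace 𝓘(ℝ, E) x →L[ℝ] ℝ :=
  show E →L[ℝ] ℝ from ((Module.finBasis ℝ E).coord i).toContinuousLinearMap

/-- The covariant derivative of 1-forms,
`∇_v η = ∑ i, (v (η (∂_i)) - η (∇_v ∂_i)) dx^i` with `v = X x`. -/
def nablaForm (D : CovariantDerivative 𝓘(ℝ, E) E (TangentSpace 𝓘(ℝ, E) : M → Type _))
    (X : ∀ x : M, TangentSpace 𝓘(ℝ, E) x) (η : ∀ x : M, TangentSpace 𝓘(ℝ, E) x →L[ℝ] ℝ)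
    (x : M) : TangentSpace 𝓘(ℝ, E) x →L[ℝ] ℝ :=
  ∑ i, (d% (fun y ↦ η y (coordField x i y)) x (X x) - η x (D (coordField x i) x (X x)))
    • coordForm x i

variable (g : ContMDiffRiemannianMetric 𝓘(ℝ, E) ∞ E (TangentSpace 𝓘(ℝ, E) : M → Type _))

/-- Lowering an index, `v ↦ g(v, ·)`. -/
def flat (x : M) : TangentSpace 𝓘(ℝ, E) x →ₗ[ℝ] (TangentSpace 𝓘(ℝ, E) x →L[ℝ] ℝ) :=
  (g.inner x).toLinearMap

theorem flat_bijective (x : M) : Function.Bijective (flat g x) := by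
  have hinj : Function.Injective (flat g x) := by
    rw [← LinearMap.ker_eq_bot, LinearMap.ker_eq_bot']
    intro v hv
    by_contra h
    have h1 := g.pos x v h
    have h2 : g.inner x v = 0 := hv
    rw [h2] at h1
    simp at h1
  have : FiniteDimensional ℝ (TangentSpace 𝓘(ℝ, E) x) := inferInstanceAs (FiniteDimensional ℝ E)
  have : FiniteDimensional ℝ (TangentSpace 𝓘(ℝ, E) x →L[ℝ] ℝ) :=
    inferInstanceAs (FiniteDimensional ℝ (E →L[ℝ] ℝ))
  have hd : Module.finrank ℝ (TangentSpace 𝓘(ℝ, E) x)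
      = Module.finrank ℝ (TangentSpace 𝓘(ℝ, E) x →L[ℝ] ℝ) := by
    change Module.finrank ℝ E = Module.finrank ℝ (E →L[ℝ] ℝ)
    rw [← (LinearMap.toContinuousLinearMap (𝕜 := ℝ) (E := E) (F' := ℝ)).finrank_eq]
    exact (Subspace.dual_finrank_eq (K := ℝ) (V := E)).symm
  exact ⟨hinj, (LinearMap.injective_iff_surjective_of_finrank_eq_finrank hd).1 hinj⟩

/-- Raising an index: the vector `g⁻¹ ∘ η` with `g(g⁻¹ ∘ η, ·) = η`. -/
def sharp (x : M) : (TangentSpace 𝓘(ℝ, E) x →L[ℝ] ℝ) →ₗ[ℝ] TangentSpace 𝓘(ℝ, E) x :=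
  (LinearEquiv.ofBijective (flat g x) (flat_bijective g x)).symm.toLinearMap

theorem inner_sharp (x : M) (η : TangentSpace 𝓘(ℝ, E) x →L[ℝ] ℝ) :
    g.inner x (sharp g x η) = η :=
  (LinearEquiv.ofBijective (flat g x) (flat_bijective g x)).apply_symm_apply η

/-- The inverse metric `g⁻¹(η, ζ) = g^{ij} η_i ζ_j` on covectors. -/
def cometric (x : M) (η ζ : TangentSpace 𝓘(ℝ, E) x →L[ℝ] ℝ) : ℝ :=
  η (sharp g x ζ)

/-- The gradient of `f`. -/
def grad (f : M → ℝ) (x : M) : TangentSpace 𝓘(ℝ, E) x :=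
  sharp g x (d% f x)

/-- The tensor `A(X, Y) = (1 / (2 f)) (X(f) Y + Y(f) X - g(X, Y) grad f)`. -/
def tensorA (f : M → ℝ) (X Y : ∀ x : M, TangentSpace 𝓘(ℝ, E) x) (x : M) :
    TangentSpace 𝓘(ℝ, E) x :=
  (1 / (2 * f x)) • (d% f x (X x) • Y x + d% f x (Y x) • X x - g.inner x (X x) (Y x) • grad g f x)

end Base

/-! ### The cotangent bundle -/

section Cotangent

variable {E : Type*} [NormedAddCommGroup E] [NormedSpace ℝ E] [FiniteDimensional ℝ E]
  {M : Type*} [TopologicalSpace M] [ChartedSpace E M] [IsManifold 𝓘(ℝ, E) ∞ M]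

variable (E M) in
/-- The cotangent bundle `T*M`; its points are pairs `p = ⟨x, p_x⟩`. -/
abbrev Cotangent : Type _ :=
  TotalSpace (E →L[ℝ] ℝ) (fun x : M ↦ TangentSpace 𝓘(ℝ, E) x →L[ℝ] ℝ)

variable (E) in
/-- The model `E × E*` of the manifold `T*M`. -/
abbrev cotModel : ModelWithCorners ℝ (E × (E →L[ℝ] ℝ)) (ModelProd E (E →L[ℝ] ℝ)) :=
  𝓘(ℝ, E).prod 𝓘(ℝ, E →L[ℝ] ℝ)

/- The preferred chart of `T*M` at `p` is the chart `(x^i, p_i)` induced by the preferred chart of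
`M` at `π(p)`, and Mathlib's tangent space of `T*M` at `p` is the model space `E × E*` read in that
chart: the pair `(a, b)` is the tangent vector `a^i ∂/∂x^i + b_i ∂/∂p_i`. -/

/-- The vertical lift `η_i ∂/∂p_i` of a covector. -/
def vlift (p : Cotangent E M) (η : TangentSpace 𝓘(ℝ, E) p.1 →L[ℝ] ℝ) :
    TangentSpace (cotModel E) p :=
  ((0 : E), (η : E →L[ℝ] ℝ))

/-- The covector with components `p_h Γ^h_{ij} v^j`. -/
def christoffelForm (D : CovariantDerivative 𝓘(ℝ, E) E (TangentSpace 𝓘(ℝ, E) : M → Type _))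
    (p : Cotangent E M) (v : TangentSpace 𝓘(ℝ, E) p.1) : TangentSpace 𝓘(ℝ, E) p.1 →L[ℝ] ℝ :=
  ∑ i, p.2 (D (coordField p.1 i) p.1 v) • coordForm p.1 i

/-- The horizontal lift `v^i ∂/∂x^i + p_h Γ^h_{ij} v^j ∂/∂p_i` of a tangent vector. -/
def hlift (D : CovariantDerivative 𝓘(ℝ, E) E (TangentSpace 𝓘(ℝ, E) : M → Type _))
    (p : Cotangent E M) (v : TangentSpace 𝓘(ℝ, E) p.1) : TangentSpace (cotModel E) p :=
  ((v : E), (christoffelForm D p v : E →L[ℝ] ℝ))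

/-- The projection `dπ` of a tangent vector of `T*M`, see `horPart_eq_mfderiv`. -/
def horPart (p : Cotangent E M) (u : TangentSpace (cotModel E) p) : TangentSpace 𝓘(ℝ, E) p.1 :=
  (show E × (E →L[ℝ] ℝ) from u).1

/-- The vertical component of a tangent vector of `T*M`, see `hlift_add_vlift`. -/
def verPart (D : CovariantDerivative 𝓘(ℝ, E) E (TangentSpace 𝓘(ℝ, E) : M → Type _))
    (p : Cotangent E M) (u : TangentSpace (cotModel E) p) : TangentSpace 𝓘(ℝ, E) p.1 →L[ℝ] ℝ :=
  (show TangentSpace 𝓘(ℝ, E) p.1 →L[ℝ] ℝ from (show E × (E →L[ℝ] ℝ) from u).2)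
    - christoffelForm D p (horPart p u)

section Decomposition

variable (D : CovariantDerivative 𝓘(ℝ, E) E (TangentSpace 𝓘(ℝ, E) : M → Type _))
  (p : Cotangent E M)

theorem hlift_add_vlift (u : TangentSpace (cotModel E) p) :
    hlift D p (horPart p u) + vlift p (verPart D p u) = u := by
  refine Prod.ext ?_ ?_
  · exact add_zero _
  · exact add_sub_cancel (christoffelForm D p (horPart p u)) _

@[simp] theorem horPart_hlift (v : TangentSpace 𝓘(ℝ, E) p.1) : horPart p (hlift D p v) = v := rfl

@[simp] theorem horPart_vlift (η : TangentSpace 𝓘(ℝ, E) p.1 →L[ℝ] ℝ) :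
    horPart p (vlift p η) = 0 := rfl

@[simp] theorem verPart_hlift (v : TangentSpace 𝓘(ℝ, E) p.1) : verPart D p (hlift D p v) = 0 :=
  sub_self (christoffelForm D p v)

@[simp] theorem christoffelForm_zero : christoffelForm D p 0 = 0 := by
  simp [christoffelForm]

@[simp] theorem verPart_vlift (η : TangentSpace 𝓘(ℝ, E) p.1 →L[ℝ] ℝ) :
    verPart D p (vlift p η) = η := by
  change η - christoffelForm D p 0 = η
  simp

end Decomposition

/-- The vertical lift `^V η` of a 1-form. -/
def vertLift (η : ∀ x : M, TangentSpace 𝓘(ℝ, E) x →L[ℝ] ℝ) (p : Cotangent E M) :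
    TangentSpace (cotModel E) p :=
  vlift p (η p.1)

/-- The horizontal lift `^H X` of a vector field. -/
def horLift (D : CovariantDerivative 𝓘(ℝ, E) E (TangentSpace 𝓘(ℝ, E) : M → Type _))
    (X : ∀ x : M, TangentSpace 𝓘(ℝ, E) x) (p : Cotangent E M) : TangentSpace (cotModel E) p :=
  hlift D p (X p.1)

/-- The Liouville vector field `γδ = p_i ∂/∂p_i`. -/
def liouville (p : Cotangent E M) : TangentSpace (cotModel E) p :=
  vlift p p.2

/-- The almost paracomplex structure `J (^H X) = - ^H X`, `J (^V η) = ^V η`. -/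
def structJ (D : CovariantDerivative 𝓘(ℝ, E) E (TangentSpace 𝓘(ℝ, E) : M → Type _))
    (p : Cotangent E M) (u : TangentSpace (cotModel E) p) : TangentSpace (cotModel E) p :=
  vlift p (verPart D p u) - hlift D p (horPart p u)

variable (g : ContMDiffRiemannianMetric 𝓘(ℝ, E) ∞ E (TangentSpace 𝓘(ℝ, E) : M → Type _))

/-- The function `α = 1 + g⁻¹(p, p)`. -/
def alpha (p : Cotangent E M) : ℝ := 1 + cometric g p.1 p.2 p.2

/-- The rescaled Riemannian metric of Cheeger-Gromoll type on `T*M`. -/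
def cgMetric (f : M → ℝ)
    (D : CovariantDerivative 𝓘(ℝ, E) E (TangentSpace 𝓘(ℝ, E) : M → Type _))
    (p : Cotangent E M) (u w : TangentSpace (cotModel E) p) : ℝ :=
  f p.1 * g.inner p.1 (horPart p u) (horPart p w)
    + 1 / alpha g p * (cometric g p.1 (verPart D p u) (verPart D p w)
      + cometric g p.1 (verPart D p u) p.2 * cometric g p.1 (verPart D p w) p.2)

/-- The tangent vector of `M` at `π(p)` written `p (g⁻¹ ∘ R( · , Y) W)`, that is the vector
`∑ t, p (R(∂_t, Y) W) (g⁻¹ ∘ dx^t)`, obtained from the covector `p (R( · , Y) W)` by raising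
the index. -/
def curvVector (D : CovariantDerivative 𝓘(ℝ, E) E (TangentSpace 𝓘(ℝ, E) : M → Type _))
    (p : Cotangent E M) (Y W : ∀ x : M, TangentSpace 𝓘(ℝ, E) x) : TangentSpace 𝓘(ℝ, E) p.1 :=
  ∑ t, p.2 (curvature D (coordField p.1 t) Y W p.1) • sharp g p.1 (coordForm p.1 t)

section Checks

variable (f : M → ℝ) (D : CovariantDerivative 𝓘(ℝ, E) E (TangentSpace 𝓘(ℝ, E) : M → Type _))
  (p : Cotangent E M)

theorem structJ_hlift (v : TangentSpace 𝓘(ℝ, E) p.1) :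
    structJ D p (hlift D p v) = - hlift D p v := by
  have h : vlift p 0 = 0 := rfl
  simp [structJ, h]

theorem structJ_vlift (η : TangentSpace 𝓘(ℝ, E) p.1 →L[ℝ] ℝ) :
    structJ D p (vlift p η) = vlift p η := by
  have h : hlift D p 0 = 0 := by
    refine Prod.ext rfl ?_
    exact christoffelForm_zero D p
  simp [structJ, h]

theorem cometric_zero_left (x : M) (η : TangentSpace 𝓘(ℝ, E) x →L[ℝ] ℝ) :
    cometric g x 0 η = 0 := by simp [cometric]

theorem cgMetric_vlift_vlift (η ζ : TangentSpace 𝓘(ℝ, E) p.1 →L[ℝ] ℝ) :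
    cgMetric g f D p (vlift p η) (vlift p ζ)
      = 1 / alpha g p * (cometric g p.1 η ζ + cometric g p.1 η p.2 * cometric g p.1 ζ p.2) := by
  simp [cgMetric]

theorem cgMetric_vlift_hlift (η : TangentSpace 𝓘(ℝ, E) p.1 →L[ℝ] ℝ)
    (v : TangentSpace 𝓘(ℝ, E) p.1) : cgMetric g f D p (vlift p η) (hlift D p v) = 0 := by
  simp [cgMetric, cometric]

theorem cgMetric_hlift_hlift (v w : TangentSpace 𝓘(ℝ, E) p.1) :
    cgMetric g f D p (hlift D p v) (hlift D p w) = f p.1 * g.inner p.1 v w := by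
  simp [cgMetric, cometric]

end Checks

end Cotangent

/-! ### Consistency of the definitions on the cotangent bundle -/

section Conventions

variable {E : Type*} [NormedAddCommGroup E] [NormedSpace ℝ E] [FiniteDimensional ℝ E]
  {M : Type*} [TopologicalSpace M] [ChartedSpace E M] [IsManifold 𝓘(ℝ, E) ∞ M]

theorem cot_chart (p q : Cotangent E M) :
    extChartAt (cotModel E) p q =
      (chartAt E p.1 q.1, ContinuousLinearMap.inCoordinates E (TangentSpace 𝓘(ℝ, E) : M → Type _) ℝ
        (Bundle.Trivial M ℝ) p.1 q.1 p.1 q.1 q.2) := by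
  have := hom_chart (HB := E) (E₁ := (TangentSpace 𝓘(ℝ, E) : M → Type _)) (F₁ := E) (F₂ := ℝ) (E₂ := fun _ : M ↦ ℝ) (𝕜 := ℝ) p q
  rw [← this]
  rfl

/-- `horPart` is the differential of the projection `π : T*M → M`. -/
theorem horPart_eq_mfderiv (p : Cotangent E M) (u : TangentSpace (cotModel E) p) :
    horPart p u = mfderiv (cotModel E) 𝓘(ℝ, E) (TotalSpace.proj : Cotangent E M → M) p u := by
  have h : HasMFDerivAt (cotModel E) 𝓘(ℝ, E) (TotalSpace.proj : Cotangent E M → M) p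
      (show E × (E →L[ℝ] ℝ) →L[ℝ] E from ContinuousLinearMap.fst ℝ E (E →L[ℝ] ℝ)) := by
    refine ⟨(FiberBundle.continuous_proj _ _).continuousAt, ?_⟩
    have h1 : HasFDerivWithinAt (Prod.fst : E × (E →L[ℝ] ℝ) → E)
        (ContinuousLinearMap.fst ℝ E (E →L[ℝ] ℝ)) (Set.range (cotModel E))
        (extChartAt (cotModel E) p p) := hasFDerivWithinAt_fst
    refine h1.congr_of_eventuallyEq ?_ ?_
    · filter_upwards [extChartAt_target_mem_nhdsWithin (I := cotModel E) p] with z hz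
      have h2 := (extChartAt (cotModel E) p).right_inv hz
      rw [cot_chart] at h2
      exact congrArg Prod.fst h2
    · change chartAt E p.1 ((extChartAt (cotModel E) p).symm (extChartAt (cotModel E) p p)).1 = (extChartAt (cotModel E) p p).1
      rw [extChartAt_to_inv, cot_chart]
  rw [h.mfderiv]
  rfl

theorem triv_self (x : M) (v : TangentSpace 𝓘(ℝ, E) x) :
    (trivializationAt E (TangentSpace 𝓘(ℝ, E) : M → Type _) x ⟨x, v⟩).2 = v := by
  have := FiberBundleCore.localTrivAt_apply_mk (tangentBundleCore 𝓘(ℝ, E) M).toFiberBundleCore x v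
  exact congrArg Prod.snd this

theorem inCoord_apply (x y : M) (hy : y ∈ (trivializationAt E (TangentSpace 𝓘(ℝ, E) : M → Type _) x).baseSet) (η : TangentSpace 𝓘(ℝ, E) y →L[ℝ] ℝ) (v : E) :
    ContinuousLinearMap.inCoordinates E (TangentSpace 𝓘(ℝ, E) : M → Type _) ℝ
        (Bundle.Trivial M ℝ) x y x y η v =
      η ((trivializationAt E (TangentSpace 𝓘(ℝ, E) : M → Type _) x).symm y v) := by
  rw [ContinuousLinearMap.inCoordinates]
  simp [Trivialization.symmL_apply _ hy]

theorem symm_self (x : M) (v : E) :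
    (trivializationAt E (TangentSpace 𝓘(ℝ, E) : M → Type _) x).symm x v = v := by
  have h := FiberBundle.extend_apply_self E (show TangentSpace 𝓘(ℝ, E) x from v)
  rw [FiberBundle.extend, triv_self] at h
  exact h

theorem fiber_coord (p : Cotangent E M) (η : TangentSpace 𝓘(ℝ, E) p.1 →L[ℝ] ℝ) :
    extChartAt (cotModel E) p (⟨p.1, η⟩ : Cotangent E M) = (chartAt E p.1 p.1, (η : E →L[ℝ] ℝ)) := by
  rw [cot_chart]
  refine Prod.ext rfl ?_
  ext v
  refine (inCoord_apply _ _ (FiberBundle.mem_baseSet_trivializationAt' _) _ _).trans ?_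
  exact congrArg η (symm_self p.1 v)

theorem hasFDerivWithinAt_line {F G : Type*} [NormedAddCommGroup F] [NormedSpace ℝ F] [NormedAddCommGroup G] [NormedSpace ℝ G]
   (c : F) (a b : G) (s : Set ℝ) (t : ℝ) : HasFDerivWithinAt (fun t : ℝ ↦ (c, a + t • b)) (ContinuousLinearMap.smulRight (1 : ℝ →L[ℝ] ℝ) ((0 : F), b)) s t := by
  refine (HasFDerivAt.congr_fderiv (HasFDerivAt.prodMk (hasFDerivAt_const _ _) (f₂' :=
        ContinuousLinearMap.smulRight (1 : ℝ →L[ℝ] ℝ) b) ?_) ?_).hasFDerivWithinAt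
  · refine HasFDerivAt.const_add _ ?_
    exact (ContinuousLinearMap.smulRight (1 : ℝ →L[ℝ] ℝ) b).hasFDerivAt
  · ext1
    simp

/-- The vertical lift of `η` at `p` is the velocity of the curve `t ↦ p + t η` in the fibre. -/
theorem mfderiv_curve_eq_vlift (p : Cotangent E M) (η : TangentSpace 𝓘(ℝ, E) p.1 →L[ℝ] ℝ) :
    mfderiv 𝓘(ℝ, ℝ) (cotModel E) (fun t : ℝ ↦ (⟨p.1, p.2 + t • η⟩ : Cotangent E M)) 0 (1 : ℝ)
      = vlift p η := by
  have h : HasMFDerivAt 𝓘(ℝ, ℝ) (cotModel E)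
      (fun t : ℝ ↦ (⟨p.1, p.2 + t • η⟩ : Cotangent E M)) 0
      (show ℝ →L[ℝ] E × (E →L[ℝ] ℝ) from
        ContinuousLinearMap.smulRight (1 : ℝ →L[ℝ] ℝ) ((0 : E), (η : E →L[ℝ] ℝ))) := by
    refine ⟨?_, ?_⟩
    · have h1 : Continuous (fun t : ℝ ↦ p.2 + t • η) := by fun_prop
      exact ((FiberBundle.continuous_totalSpaceMk (E →L[ℝ] ℝ)
        (fun x : M ↦ TangentSpace 𝓘(ℝ, E) x →L[ℝ] ℝ) p.1).comp h1).continuousAt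
    · have h2 : writtenInExtChartAt 𝓘(ℝ, ℝ) (cotModel E) 0
          (fun t : ℝ ↦ (⟨p.1, p.2 + t • η⟩ : Cotangent E M))
          = fun t : ℝ ↦ (chartAt E p.1 p.1, ((p.2 : E →L[ℝ] ℝ) + t • (η : E →L[ℝ] ℝ))) := by
        funext t
        have h3 : (⟨p.1, p.2 + (0 : ℝ) • η⟩ : Cotangent E M) = p := by
          rw [zero_smul, add_zero]
        change extChartAt (cotModel E) (⟨p.1, p.2 + (0 : ℝ) • η⟩ : Cotangent E M)
          (⟨p.1, p.2 + t • η⟩ : Cotangent E M) = _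
        rw [h3]
        exact fiber_coord p _
      rw [h2]
      exact hasFDerivWithinAt_line (F := E) (G := E →L[ℝ] ℝ) (chartAt E p.1 p.1) p.2 η _ 0
  rw [h.mfderiv]
  exact one_smul ℝ (((0 : E), (η : E →L[ℝ] ℝ)) : E × (E →L[ℝ] ℝ))

/-- The derivative of the fibre coordinate `q ↦ q (∂_i)` of `T*M` at `p`. -/
theorem mvfderiv_eval (p : Cotangent E M) (u : TangentSpace (cotModel E) p) (i : Fin (Module.finrank ℝ E)) :
    mvfderiv (cotModel E) (fun q : Cotangent E M ↦ q.2 (coordField p.1 i q.1)) p u =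
      (show E × (E →L[ℝ] ℝ) from u).2 (Module.finBasis ℝ E i) := by
  have h : HasMFDerivAt (cotModel E) 𝓘(ℝ, ℝ) (fun q : Cotangent E M ↦ q.2 (coordField p.1 i q.1)) p
    (show E × (E →L[ℝ] ℝ) →L[ℝ] ℝ from
       (ContinuousLinearMap.apply ℝ ℝ (Module.finBasis ℝ E i)).comp
         (ContinuousLinearMap.snd ℝ E (E →L[ℝ] ℝ))) := by
    have h1 : HasFDerivWithinAt (fun z : E × (E →L[ℝ] ℝ) ↦ z.2 (Module.finBasis ℝ E i))
        ((ContinuousLinearMap.apply ℝ ℝ (Module.finBasis ℝ E i)).comp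
         (ContinuousLinearMap.snd ℝ E (E →L[ℝ] ℝ))) (Set.range (cotModel E))
        (extChartAt (cotModel E) p p) :=
      ((ContinuousLinearMap.apply ℝ ℝ (Module.finBasis ℝ E i)).comp
         (ContinuousLinearMap.snd ℝ E (E →L[ℝ] ℝ))).hasFDerivWithinAt
    have key : ∀ q : Cotangent E M, q.1 ∈ (chartAt E p.1).source → q.2 (coordField p.1 i q.1)
        = (extChartAt (cotModel E) p q).2 (Module.finBasis ℝ E i) := by
      intro q hq
      rw [cot_chart]
      dsimp only
      refine Eq.trans ?_ (inCoord_apply _ _ (by simpa using hq) _ _).symm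
      unfold coordField FiberBundle.extend
      rw [triv_self]
    have src : ∀ q ∈ (extChartAt (cotModel E) p).source, q.1 ∈ (chartAt E p.1).source := by
      intro q hq
      rw [FiberBundle.extChartAt] at hq
      simp at hq
      exact hq.1
    have key' : ∀ z ∈ (extChartAt (cotModel E) p).target,
        ((extChartAt (cotModel E) p).symm z).2
        (coordField p.1 i ((extChartAt (cotModel E) p).symm z).1) = z.2 (Module.finBasis ℝ E i) := by
      intro z hz
      rw [key _ (src _ ((extChartAt (cotModel E) p).map_target hz)), (extChartAt (cotModel E) p).right_inv hz]
    refine ⟨?_, h1.congr_of_eventuallyEq ?_ ?_⟩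
    · have hc : ContinuousAt (fun q : Cotangent E M ↦
          (extChartAt (cotModel E) p q).2 (Module.finBasis ℝ E i)) p :=
        ContinuousAt.comp (f := extChartAt (cotModel E) p)
          (g := fun z : E × (E →L[ℝ] ℝ) ↦ z.2 (Module.finBasis ℝ E i))
          (by fun_prop) (continuousAt_extChartAt p)
      refine hc.congr ?_
      have ho : ∀ᶠ q : Cotangent E M in 𝓝 p, q.1 ∈ (chartAt E p.1).source :=
        (FiberBundle.continuous_proj _ _).continuousAt.eventually
          ((chartAt E p.1).open_source.mem_nhds (mem_chart_source E p.1))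
      filter_upwards [ho] with q hq
      exact (key q hq).symm
    · filter_upwards [extChartAt_target_mem_nhdsWithin (I := cotModel E) p] with z hz
      exact key' z hz
    · exact key' _ (mem_extChartAt_target p)
  rw [mvfderiv, h.mfderiv]
  rfl

/-- The horizontal lift of `v` differentiates the function `q ↦ q (∂_i)` to `p (∇_v ∂_i)`, as the
parallel transport of `p` along `v` does. -/
theorem hlift_eval (D : CovariantDerivative 𝓘(ℝ, E) E (TangentSpace 𝓘(ℝ, E) : M → Type _))
    (p : Cotangent E M) (v : TangentSpace 𝓘(ℝ, E) p.1) (i : Fin (Module.finrank ℝ E)) :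
    mvfderiv (cotModel E) (fun q : Cotangent E M ↦ q.2 (coordField p.1 i q.1)) p (hlift D p v)
      = p.2 (D (coordField p.1 i) p.1 v) := by
  rw [mvfderiv_eval]
  change christoffelForm D p v (show TangentSpace 𝓘(ℝ, E) p.1 from Module.finBasis ℝ E i) = _
  have hc : ∀ j, coordForm p.1 j (show TangentSpace 𝓘(ℝ, E) p.1 from Module.finBasis ℝ E i) = if i = j then 1 else 0 := by
    intro j
    change (Module.finBasis ℝ E).coord j (Module.finBasis ℝ E i) = _
    simp [Finsupp.single_apply]
  have e : christoffelForm D p v (show TangentSpace 𝓘(ℝ, E) p.1 from Module.finBasis ℝ E i)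
     = ∑ j, p.2 (D (coordField p.1 j) p.1 v) * (if i = j then 1 else 0) := by
    rw [christoffelForm, _root_.sum_apply]
    refine Finset.sum_congr rfl fun j _ ↦ ?_
    rw [← hc j]
    rfl
  rw [e]
  simp

end Conventions

end CheegerGromoll

end

open Bundle NormedSpace
open scoped Manifold ContDiff Topology

set_option linter.unusedSectionVars false

noncomputable section

namespace CheegerGromoll

/-! ### Vector fields on a manifold: brackets as commutators, differentiability, global extension.
-/

section VectorFields

variable {E : Type*} [NormedAddCommGroup E] [NormedSpace ℝ E] [FiniteDimensional ℝ E]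
  {H : Type*} [TopologicalSpace H] {I : ModelWithCorners ℝ E H}
  {N : Type*} [TopologicalSpace N] [ChartedSpace H N] [IsManifold I ∞ N]

/-! A tangent vector `u` of `T*M` at `q` is known once its horizontal and vertical components are.
The horizontal one is seen by functions `φ ∘ π`, the vertical one by the functions `q ↦ q(W)` with
`W` a vector field on `M`, since `u(q(W)) = q(∇_{dπ u} W) + (ver u)(W)` (`mvfderiv_evalField`). On
these functions the lifts act simply: `^HX` sends `q(W)` to `q(∇_X W)`, and `^Vθ` sends it to `θ(W)
∘ π`. As a Lie bracket acts by the commutator (`mvfderiv_mlieBracket`), this yields without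
Christoffel symbols that `[^HX, ^HY]` has horizontal part `[X, Y]` and vertical part `p(R(X, Y) ·)`,
that `[^HX, ^Vθ] = ^V(∇_X θ)`, and that `[^Vη, ^Vθ] = 0`.

The other input is `dα(u) = 2 g⁻¹(ver u, p)` (`mvfderiv_alpha`). So `α` is constant along horizontal
lifts, and the vertical part of `[^HX, ^HY]` is orthogonal to `p`. With this, the Koszul formula on
lifts gives the components of `∇~` that are needed: `hor ∇~_{HX} HY = ∇_X Y + A(X, Y)`, `ver ∇~_{Vθ}
HX = 0`, `hor ∇~_{HY} Vη = (1 / (2 f α)) p(g⁻¹ ∘ R(·, Y) η~)`, and `ver ∇~_{Vη} Vθ`, which is the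
expression of the fourth formula.

The rest is algebra. That the product connection preserves `J` uses only `J² = 1`. If `JU = εU` and
`JV = δV`, the product connection applied to `U, V` is the projection to the `δ`-eigenspace of `J`
of `∇~_U V`, to which `2 ∇~_V U` is added when `ε = -δ` (`horPart_productConnection`,
`verPart_productConnection`). For `^HX, ^Vθ` the added term vanishes and torsion-freeness leaves
`ver [^HX, ^Vθ] = ∇_X θ`. For `^Vη, ^HY` the bracket is vertical, so both derivatives have the same
horizontal part, and `1 + 2` produces the factor `3`. -/

/-- The second-derivative terms of the product rule cancel by the symmetry of the Hessian. -/
theorem fderiv_lieBracket {φ : E → ℝ} {V W : E → E} {z : E} (hφ : ContDiffAt ℝ 2 φ z)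
    (hV : DifferentiableAt ℝ V z) (hW : DifferentiableAt ℝ W z) :
    fderiv ℝ φ z (VectorField.lieBracket ℝ V W z) =
      fderiv ℝ (fun y ↦ fderiv ℝ φ y (W y)) z (V z)
        - fderiv ℝ (fun y ↦ fderiv ℝ φ y (V y)) z (W z) := by
  have h1 : DifferentiableAt ℝ (fderiv ℝ φ) z :=
    (hφ.fderiv_right (m := 1) (by norm_num)).differentiableAt (by norm_num)
  have h2 := (hφ.isSymmSndFDerivAt (by simp)).eq (V z) (W z)
  rw [fderiv_clm_apply h1 hW, fderiv_clm_apply h1 hV]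
  simp only [VectorField.lieBracket_eq, map_sub, add_apply, ContinuousLinearMap.comp_apply,
    ContinuousLinearMap.flip_apply, h2]
  ring

theorem mvfderiv_eq_fderiv_comp_extChartAt [I.Boundaryless] {φ : N → ℝ} {x y : N}
    (hy : y ∈ (extChartAt I x).source) (hφ : MDifferentiableAt I 𝓘(ℝ, ℝ) φ y)
    (u : TangentSpace I y) :
    mvfderiv I φ y u =
      fderiv ℝ (φ ∘ (extChartAt I x).symm) (extChartAt I x y)
        (mfderiv I 𝓘(ℝ, E) (extChartAt I x) y u) := by
  have h0 : (extChartAt I x).symm (extChartAt I x y) = y := (extChartAt I x).left_inv hy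
  have hs : MDifferentiableAt 𝓘(ℝ, E) I (extChartAt I x).symm (extChartAt I x y) := by
    have := (contMDiffOn_extChartAt_symm (I := I) (n := ∞) x).contMDiffAt
      ((isOpen_extChartAt_target x).mem_nhds ((extChartAt I x).map_source hy))
    exact this.mdifferentiableAt (by simp)
  have he : MDifferentiableAt I 𝓘(ℝ, E) (extChartAt I x) y :=
    mdifferentiableAt_extChartAt (by simpa using hy)
  have hc : MDifferentiableAt 𝓘(ℝ, E) 𝓘(ℝ, ℝ) (φ ∘ (extChartAt I x).symm) (extChartAt I x y) :=
    MDifferentiableAt.comp _ (by rw [h0]; exact hφ) hs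
  have h1 : φ =ᶠ[𝓝 y] (φ ∘ (extChartAt I x).symm) ∘ extChartAt I x := by
    filter_upwards [(isOpen_extChartAt_source x).mem_nhds hy] with w hw
    exact congrArg φ ((extChartAt I x).left_inv hw).symm
  have h2 : mfderiv I 𝓘(ℝ, ℝ) φ y =
      (mfderiv 𝓘(ℝ, E) 𝓘(ℝ, ℝ) (φ ∘ (extChartAt I x).symm) (extChartAt I x y)).comp
        (mfderiv I 𝓘(ℝ, E) (extChartAt I x) y) := by
    rw [h1.mfderiv_eq, mfderiv_comp y hc he]
  have h3 := mfderiv_eq_fderiv (𝕜 := ℝ) (f := φ ∘ (extChartAt I x).symm) (x := extChartAt I x y)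
  rw [mvfderiv, h2, h3]
  rfl

/-- The Lie bracket of vector fields acts on functions as the commutator of derivations. -/
theorem mvfderiv_mlieBracket [I.Boundaryless] {φ : N → ℝ} {V W : ∀ y : N, TangentSpace I y} {x : N}
    (hφ : ContMDiffAt I 𝓘(ℝ, ℝ) 2 φ x) (hV : MDiffAt (T% V) x) (hW : MDiffAt (T% W) x) :
    mvfderiv I φ x (VectorField.mlieBracket I V W x) =
      mvfderiv I (fun y ↦ mvfderiv I φ y (W y)) x (V x)
        - mvfderiv I (fun y ↦ mvfderiv I φ y (V y)) x (W x) := by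
  have : IsManifold I 2 N := IsManifold.of_le (n := ∞) (by norm_cast)
  have : IsManifold I 1 N := IsManifold.of_le (n := ∞) (by norm_cast)
  set e := extChartAt I x with he
  have hself (u : TangentSpace I x) : mfderiv I 𝓘(ℝ, E) e x u = u := by
    rw [he, mfderiv_extChartAt_self]
    rfl
  -- The field read in the chart at `x`. Since the differential of this chart at `x` is the
  -- identity, the bracket at `x` is the flat bracket of the fields so read, and the claim reduces
  -- to `fderiv_lieBracket`.
  let pull (U : ∀ y : N, TangentSpace I y) : E → E :=
    VectorField.mpullbackWithin 𝓘(ℝ, E) I e.symm U (Set.range I)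
  have hpull (U : ∀ y : N, TangentSpace I y) : ∀ᶠ y in 𝓝 x,
      pull U (e y) = mfderiv I 𝓘(ℝ, E) e y (U y) := by
    have h1 := VectorField.eventuallyEq_mpullback_mpullbackWithin_extChartAt
      (I := I) (s := Set.univ) (x := x) U
    rw [nhdsWithin_univ] at h1
    filter_upwards [h1, extChartAt_source_mem_nhds (I := I) x] with y hy hys
    rw [hy]
    exact ((isInvertible_mfderiv_extChartAt hys).self_apply_inverse _).symm
  have hdiff {U : ∀ y : N, TangentSpace I y} (hU : MDiffAt (T% U) x) :
      DifferentiableAt ℝ (pull U) (e x) := by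
    have h1 := MDifferentiableWithinAt.differentiableWithinAt_mpullbackWithin_vectorField
      (I := I) (s := Set.univ) hU.mdifferentiableWithinAt
    exact DifferentiableWithinAt.differentiableAt h1 (by simp [I.range_eq_univ])
  have hbr : VectorField.mlieBracket I V W x
      = VectorField.lieBracket ℝ (pull V) (pull W) (e x) := by
    rw [← VectorField.mlieBracketWithin_univ, VectorField.mlieBracketWithin_apply,
      Set.preimage_univ, Set.univ_inter, mfderiv_extChartAt_self]
    have h2 := VectorField.lieBracketWithin_univ (𝕜 := ℝ) (V := pull V) (W := pull W)
    rw [← h2, ← I.range_eq_univ]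
    exact congrArg (fun A : E →L[ℝ] E ↦ A _) ContinuousLinearMap.inverse_id
  have hφ' : ContDiffAt ℝ 2 (φ ∘ e.symm) (e x) := by
    have h1 := (contMDiffAt_iff_source (I := I) (x := x) (f := φ)).1 hφ
    rw [I.range_eq_univ, contMDiffWithinAt_univ] at h1
    exact h1.contDiffAt
  have hφn : ∀ᶠ y in 𝓝 x, ContMDiffAt I 𝓘(ℝ, ℝ) 2 φ y :=
    (contMDiffAt_iff_contMDiffAt_nhds (by simp)).1 hφ
  have hψ {U : ∀ y : N, TangentSpace I y} (hU : MDiffAt (T% U) x) (u : TangentSpace I x) :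
      mvfderiv I (fun y ↦ mvfderiv I φ y (U y)) x u =
        fderiv ℝ (fun z ↦ fderiv ℝ (φ ∘ e.symm) z (pull U z)) (e x) u := by
    have h1 : (fun y ↦ mvfderiv I φ y (U y)) =ᶠ[𝓝 x]
        (fun z ↦ fderiv ℝ (φ ∘ e.symm) z (pull U z)) ∘ e := by
      filter_upwards [hpull U, extChartAt_source_mem_nhds (I := I) x, hφn]
        with y hy hys hyφ
      rw [mvfderiv_eq_fderiv_comp_extChartAt hys (hyφ.mdifferentiableAt (by norm_num))]
      exact congrArg _ hy.symm
    have h2 : DifferentiableAt ℝ (fun z ↦ fderiv ℝ (φ ∘ e.symm) z (pull U z)) (e x) :=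
      ((hφ'.fderiv_right (m := 1) (by norm_num)).differentiableAt (by norm_num)).clm_apply
        (hdiff hU)
    have h3 : mvfderiv I ((fun z ↦ fderiv ℝ (φ ∘ e.symm) z (pull U z)) ∘ e) x u =
        mvfderiv 𝓘(ℝ, E) (fun z ↦ fderiv ℝ (φ ∘ e.symm) z (pull U z)) (e x)
          (mfderiv I 𝓘(ℝ, E) e x u) :=
      mvfderiv_comp_apply x h2.mdifferentiableAt (mdifferentiableAt_extChartAt (by simp)) u
    have h4 := mfderiv_eq_fderiv (𝕜 := ℝ) (x := e x)
      (f := fun z ↦ fderiv ℝ (φ ∘ e.symm) z (pull U z))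
    rw [mvfderiv, h1.mfderiv_eq]
    refine h3.trans ?_
    rw [hself, mvfderiv, h4]
    rfl
  have hL (u : TangentSpace I x) : mvfderiv I φ x u = fderiv ℝ (φ ∘ e.symm) (e x) u := by
    rw [mvfderiv_eq_fderiv_comp_extChartAt (x := x) (mem_extChartAt_source x)
      (hφ.mdifferentiableAt (by norm_num))]
    exact congrArg _ (hself u)
  rw [hψ hV, hψ hW, hL]
  refine (congrArg (fderiv ℝ (φ ∘ e.symm) (e x)) hbr).trans ?_
  refine (fderiv_lieBracket hφ' (hdiff hV) (hdiff hW)).trans ?_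
  have h5 (U : ∀ y : N, TangentSpace I y) : pull U (e x) = U x :=
    (hpull U).self_of_nhds.trans (hself _)
  rw [h5 V, h5 W]

/-- The trivialization of the tangent bundle at `x` is the differential of the chart at `x`. -/
theorem mdifferentiableAt_vectorField_iff {U : ∀ y : N, TangentSpace I y} {x : N} :
    MDiffAt (T% U) x ↔
      MDifferentiableAt I 𝓘(ℝ, E) (fun y ↦ mfderiv I 𝓘(ℝ, E) (extChartAt I x) y (U y)) x := by
  have : IsManifold I 1 N := IsManifold.of_le (n := ∞) (by norm_cast)
  rw [mdifferentiableAt_section]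
  refine Filter.EventuallyEq.mdifferentiableAt_iff ?_
  filter_upwards [extChartAt_source_mem_nhds (I := I) x] with y hy
  have h : MDifferentiableAt I 𝓘(ℝ, E) (extChartAt I x) y :=
    mdifferentiableAt_extChartAt (by simpa using hy)
  have h1 : mfderiv I 𝓘(ℝ, E) (extChartAt I x) y = _ := if_pos h
  rw [TangentBundle.trivializationAt_apply, h1]
  rfl

/-- Cutting off a local extension by a bump function keeps its germ. This lets local frames be
replaced by global smooth fields, so that later lemmas can assume global smoothness; the Hausdorff
property is needed for the cut-off. -/
theorem exists_contMDiff_eq_extend {F : Type*} [NormedAddCommGroup F] [NormedSpace ℝ F]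
    {V : N → Type*} [TopologicalSpace (TotalSpace F V)] [∀ x, AddCommGroup (V x)]
    [∀ x, Module ℝ (V x)] [∀ x, TopologicalSpace (V x)] [FiberBundle F V] [VectorBundle ℝ F V]
    [ContMDiffVectorBundle ∞ F V I] [T2Space N] {x : N} (v : V x) :
    ∃ W : ∀ y : N, V y, ContMDiff I (I.prod 𝓘(ℝ, F)) ∞ (fun y ↦ TotalSpace.mk' F y (W y)) ∧
      ∀ᶠ y in 𝓝 x, W y = FiberBundle.extend F v y := by
  obtain ⟨s, hs, hW⟩ := FiberBundle.exists_contMDiffOn_extend (k := ∞) I F v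
  obtain ⟨u, hus, hu, hxu⟩ := mem_nhds_iff.1 hs
  obtain ⟨ψ, -, hψ⟩ := (SmoothBumpFunction.nhds_basis_tsupport (I := I) x).mem_iff.1
    (hu.mem_nhds hxu)
  refine ⟨(ψ : N → ℝ) • FiberBundle.extend F v,
    ContMDiffOn.smul_section_of_tsupport ψ.contMDiff.contMDiffOn hu hψ (hW.mono hus), ?_⟩
  filter_upwards [ψ.eventuallyEq_one] with y hy
  simp [hy]

theorem mdifferentiableAt_dual_of_apply_basis {ι : Type} {F : Type*} [Fintype ι] [NormedAddCommGroup F]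
    [NormedSpace ℝ F] [FiniteDimensional ℝ F] (b : Module.Basis ι ℝ F) {h : N → F →L[ℝ] ℝ} {x : N}
    (hh : ∀ i, MDifferentiableAt I 𝓘(ℝ, ℝ) (fun y ↦ h y (b i)) x) :
    MDifferentiableAt I 𝓘(ℝ, F →L[ℝ] ℝ) h x := by
  let c (i : ι) : F →L[ℝ] ℝ := (b.coord i).toContinuousLinearMap
  have h1 : h = ∑ i, (ContinuousLinearMap.smulRight (1 : ℝ →L[ℝ] ℝ) (c i)) ∘
      fun y ↦ h y (b i) := by
    funext y
    ext v
    refine (congrArg (h y) (b.sum_repr v)).symm.trans ((map_sum _ _ _).trans ?_)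
    simp [c, mul_comm]
  rw [h1]
  refine MDifferentiableAt.sum fun i _ ↦ ?_
  exact (ContinuousLinearMap.smulRight (1 : ℝ →L[ℝ] ℝ) (c i)).differentiableAt.comp_mdifferentiableAt
    (hh i)

end VectorFields

/-! ### The functions `q ↦ q(W)` on the cotangent bundle. -/

section Evaluation

variable {E : Type*} [NormedAddCommGroup E] [NormedSpace ℝ E] [FiniteDimensional ℝ E]
  {M : Type*} [TopologicalSpace M] [ChartedSpace E M] [IsManifold 𝓘(ℝ, E) ∞ M]

/-- The function `q ↦ q (W)` on `T*M` defined by a vector field `W` on `M`. -/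
def evalField (W : ∀ x : M, TangentSpace 𝓘(ℝ, E) x) (q : Cotangent E M) : ℝ :=
  q.2 (W q.1)

theorem contMDiff_proj : ContMDiff (cotModel E) 𝓘(ℝ, E) ∞ (TotalSpace.proj : Cotangent E M → M) :=
  Bundle.contMDiff_proj _

theorem contMDiffAt_evalField {W : ∀ x : M, TangentSpace 𝓘(ℝ, E) x} {q : Cotangent E M}
    (hW : CMDiffAt ∞ (T% W) q.1) :
    ContMDiffAt (cotModel E) 𝓘(ℝ, ℝ) ∞ (evalField W) q := by
  have h1 : ContMDiffAt (cotModel E) (𝓘(ℝ, E).prod 𝓘(ℝ, ℝ)) ∞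
      (fun q : Cotangent E M ↦ TotalSpace.mk' ℝ (E := Bundle.Trivial M ℝ) q.1 (q.2 (W q.1))) q := by
    apply ContMDiffAt.clm_bundle_apply (F₁ := E)
    · exact contMDiffAt_id
    · exact ContMDiffAt.comp q hW contMDiff_proj.contMDiffAt
  exact ((contMDiffAt_totalSpace ..).1 h1).2

theorem mdifferentiableAt_evalField {W : ∀ x : M, TangentSpace 𝓘(ℝ, E) x} {q : Cotangent E M}
    (hW : MDiffAt (T% W) q.1) : MDifferentiableAt (cotModel E) 𝓘(ℝ, ℝ) (evalField W) q := by
  have h1 : MDifferentiableAt (cotModel E) (𝓘(ℝ, E).prod 𝓘(ℝ, ℝ))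
      (fun q : Cotangent E M ↦ TotalSpace.mk' ℝ (E := Bundle.Trivial M ℝ) q.1 (q.2 (W q.1))) q := by
    apply MDifferentiableAt.clm_bundle_apply (F₁ := E)
    · exact mdifferentiableAt_id
    · exact MDifferentiableAt.comp q hW (contMDiff_proj.mdifferentiableAt (by simp))
  exact ((mdifferentiableAt_totalSpace ..).1 h1).2

theorem mvfderiv_comp_proj {φ : M → ℝ} {q : Cotangent E M}
    (hφ : MDifferentiableAt 𝓘(ℝ, E) 𝓘(ℝ, ℝ) φ q.1) (u : TangentSpace (cotModel E) q) :
    mvfderiv (cotModel E) (fun q : Cotangent E M ↦ φ q.1) q u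
      = mvfderiv 𝓘(ℝ, E) φ q.1 (horPart q u) := by
  rw [horPart_eq_mfderiv]
  exact mvfderiv_comp_apply q hφ (contMDiff_proj.mdifferentiableAt (by simp)) u

theorem mdifferentiableAt_comp_proj {φ : M → ℝ} {q : Cotangent E M}
    (hφ : MDifferentiableAt 𝓘(ℝ, E) 𝓘(ℝ, ℝ) φ q.1) :
    MDifferentiableAt (cotModel E) 𝓘(ℝ, ℝ) (fun q : Cotangent E M ↦ φ q.1) q :=
  MDifferentiableAt.comp q hφ (contMDiff_proj.mdifferentiableAt (by simp))

theorem covector_ext {x : M} {η ζ : TangentSpace 𝓘(ℝ, E) x →L[ℝ] ℝ}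
    (h : ∀ i, η (coordField x i x) = ζ (coordField x i x)) : η = ζ := by
  refine ContinuousLinearMap.coe_injective ((Module.finBasis ℝ E).ext fun i ↦ ?_)
  have h1 : coordField x i x = Module.finBasis ℝ E i := FiberBundle.extend_apply_self E _
  exact (congrArg η h1).symm.trans ((h i).trans (congrArg ζ h1))

/-- The covector of `u` in the splitting of `T T*M` is measured by the functions `q ↦ q (W)`. -/
theorem mvfderiv_evalField
    (D : CovariantDerivative 𝓘(ℝ, E) E (TangentSpace 𝓘(ℝ, E) : M → Type _))
    {W : ∀ x : M, TangentSpace 𝓘(ℝ, E) x} {q : Cotangent E M} (hW : MDiffAt (T% W) q.1)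
    (u : TangentSpace (cotModel E) q) :
    mvfderiv (cotModel E) (evalField W) q u
      = q.2 (D W q.1 (horPart q u)) + verPart D q u (W q.1) := by
  -- The Leibniz terms `dφ(dπ u) q(W)` of the two summands cancel, so the difference depends only on
  -- the value of `W` at the base point. It may then be computed on the coordinate frame, where
  -- `mvfderiv_eval` and `hlift_eval` identify it.
  have hT : TensorialAt 𝓘(ℝ, E) E (fun W : ∀ x : M, TangentSpace 𝓘(ℝ, E) x ↦
      mvfderiv (cotModel E) (evalField W) q u - q.2 (D W q.1 (horPart q u))) q.1 := by
    constructor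
    · intro φ σ hφ hσ
      have h1 : evalField (φ • σ) = fun q : Cotangent E M ↦ φ q.1 * evalField σ q := by
        funext q
        simp [evalField]
      rw [h1, mvfderiv_fun_mul (mdifferentiableAt_comp_proj hφ) (mdifferentiableAt_evalField hσ),
        D.isCovariantDerivativeOn.leibniz hσ hφ]
      have h2 := mvfderiv_comp_proj hφ u
      simp only [add_apply, smul_apply, h2, evalField,
        ContinuousLinearMap.smulRight_apply, map_add, map_smul, smul_eq_mul]
      ring
    · intro σ τ hσ hτ
      have h1 : evalField (σ + τ) = fun q : Cotangent E M ↦ evalField σ q + evalField τ q := by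
        funext q
        simp [evalField]
      rw [h1, mvfderiv_fun_add (mdifferentiableAt_evalField hσ) (mdifferentiableAt_evalField hτ),
        D.isCovariantDerivativeOn.add hσ hτ]
      simp only [add_apply, map_add]
      ring
  have h3 := TensorialAt.mkHom_apply hT hW
  have h4 : TensorialAt.mkHom _ q.1 hT = verPart D q u := by
    refine covector_ext fun i ↦ ?_
    have h5 : MDiffAt (T% (coordField q.1 i)) q.1 := FiberBundle.mdifferentiableAt_extend ..
    rw [TensorialAt.mkHom_apply hT h5]
    have h6 : mvfderiv (cotModel E) (evalField (coordField q.1 i)) q u = _ := mvfderiv_eval q u i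
    have h7 := hlift_eval D q (horPart q u) i
    rw [mvfderiv_eval] at h7
    rw [h6]
    have h8 : coordField q.1 i q.1 = Module.finBasis ℝ E i := FiberBundle.extend_apply_self E _
    have h9 : christoffelForm D q (horPart q u) (coordField q.1 i q.1)
      = q.2 (D (coordField q.1 i) q.1 (horPart q u)) := (congrArg _ h8).trans h7
    rw [← h9]
    change _ = (_ - christoffelForm D q (horPart q u)) (coordField q.1 i q.1)
    rw [sub_apply]
    congr 1
    exact (congrArg (show E × (E →L[ℝ] ℝ) from u).2 h8).symm
  rw [← h4, h3]
  ring

theorem mvfderiv_evalField_hlift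
    (D : CovariantDerivative 𝓘(ℝ, E) E (TangentSpace 𝓘(ℝ, E) : M → Type _))
    {W : ∀ x : M, TangentSpace 𝓘(ℝ, E) x} {q : Cotangent E M} (hW : MDiffAt (T% W) q.1)
    (v : TangentSpace 𝓘(ℝ, E) q.1) :
    mvfderiv (cotModel E) (evalField W) q (hlift D q v) = q.2 (D W q.1 v) := by
  simp [mvfderiv_evalField D hW]

theorem mvfderiv_evalField_vlift
    (D : CovariantDerivative 𝓘(ℝ, E) E (TangentSpace 𝓘(ℝ, E) : M → Type _))
    {W : ∀ x : M, TangentSpace 𝓘(ℝ, E) x} {q : Cotangent E M} (hW : MDiffAt (T% W) q.1)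
    (η : TangentSpace 𝓘(ℝ, E) q.1 →L[ℝ] ℝ) :
    mvfderiv (cotModel E) (evalField W) q (vlift q η) = η (W q.1) := by
  simp [mvfderiv_evalField D hW]

end Evaluation

/-! ### Local frames and the smoothness of raising an index. -/

section Metric

variable {E : Type*} [NormedAddCommGroup E] [NormedSpace ℝ E] [FiniteDimensional ℝ E]
  {M : Type*} [TopologicalSpace M] [ChartedSpace E M] [IsManifold 𝓘(ℝ, E) ∞ M]

theorem contMDiff_form_apply {η : ∀ x : M, TangentSpace 𝓘(ℝ, E) x →L[ℝ] ℝ}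
    {X : ∀ x : M, TangentSpace 𝓘(ℝ, E) x}
    (hη : ContMDiff 𝓘(ℝ, E) (cotModel E) ∞ (fun x ↦ (⟨x, η x⟩ : Cotangent E M)))
    (hX : CMDiff ∞ (T% X)) : ContMDiff 𝓘(ℝ, E) 𝓘(ℝ, ℝ) ∞ (fun x ↦ η x (X x)) := by
  have h1 : ContMDiff 𝓘(ℝ, E) (𝓘(ℝ, E).prod 𝓘(ℝ, ℝ)) ∞
      (fun x : M ↦ TotalSpace.mk' ℝ (E := Bundle.Trivial M ℝ) x (η x (X x))) := by
    apply ContMDiff.clm_bundle_apply (F₁ := E)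
    · exact hη
    · exact hX
  intro q
  exact ((contMDiffAt_totalSpace ..).1 (h1 q)).2

theorem coordField_self (x : M) (i : Fin (Module.finrank ℝ E)) :
    coordField x i x = Module.finBasis ℝ E i :=
  FiberBundle.extend_apply_self E _

theorem exists_contMDiff_eq_coordField [T2Space M] (x : M) :
    ∃ W : Fin (Module.finrank ℝ E) → ∀ y : M, TangentSpace 𝓘(ℝ, E) y,
      (∀ i, CMDiff ∞ (T% (W i))) ∧ ∀ᶠ y in 𝓝 x, ∀ i, W i y = coordField x i y := by
  choose W hW hWx using fun i ↦ exists_contMDiff_eq_extend (I := 𝓘(ℝ, E)) (F := E)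
    (show TangentSpace 𝓘(ℝ, E) x from Module.finBasis ℝ E i)
  exact ⟨W, hW, Filter.eventually_all.2 hWx⟩

/-- The coframe dual to `coordField x`. -/
def coordCoframe (x : M) (i : Fin (Module.finrank ℝ E)) (y : M) :
    TangentSpace 𝓘(ℝ, E) y →L[ℝ] ℝ :=
  (show E →L[ℝ] ℝ from ((Module.finBasis ℝ E).coord i).toContinuousLinearMap).comp
    ((trivializationAt E (TangentSpace 𝓘(ℝ, E) : M → Type _) x).continuousLinearMapAt ℝ y)

theorem coordCoframe_apply {x y : M}
    (hy : y ∈ (trivializationAt E (TangentSpace 𝓘(ℝ, E) : M → Type _) x).baseSet)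
    (i : Fin (Module.finrank ℝ E)) (u : TangentSpace 𝓘(ℝ, E) y) :
    coordCoframe x i y u = (Module.finBasis ℝ E).repr
      (trivializationAt E (TangentSpace 𝓘(ℝ, E) : M → Type _) x ⟨y, u⟩).2 i := by
  change (Module.finBasis ℝ E).coord i
    ((trivializationAt E (TangentSpace 𝓘(ℝ, E) : M → Type _) x).continuousLinearMapAt ℝ y u) = _
  rw [Trivialization.continuousLinearMapAt_apply, Trivialization.linearMapAt_apply, if_pos hy]
  rfl

theorem contMDiffAt_coordCoframe_apply (x : M) (i : Fin (Module.finrank ℝ E))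
    {X : ∀ y : M, TangentSpace 𝓘(ℝ, E) y} (hX : CMDiffAt ∞ (T% X) x) :
    ContMDiffAt 𝓘(ℝ, E) 𝓘(ℝ, ℝ) ∞ (fun y ↦ coordCoframe x i y (X y)) x := by
  have h1 := (contMDiffAt_section x).1 hX
  have h2 : ContMDiffAt 𝓘(ℝ, E) 𝓘(ℝ, ℝ) ∞
      (((Module.finBasis ℝ E).coord i).toContinuousLinearMap ∘ fun y ↦
        (trivializationAt E (TangentSpace 𝓘(ℝ, E) : M → Type _) x ⟨y, X y⟩).2) x :=
    ((Module.finBasis ℝ E).coord i).toContinuousLinearMap.contDiff.contDiffAt.comp_contMDiffAt h1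
  refine h2.congr_of_eventuallyEq ?_
  filter_upwards [(trivializationAt E (TangentSpace 𝓘(ℝ, E) : M → Type _) x).open_baseSet.mem_nhds
      (FiberBundle.mem_baseSet_trivializationAt' x)] with y hy
  exact coordCoframe_apply hy i _

theorem sum_coordField {x y : M}
    (hy : y ∈ (trivializationAt E (TangentSpace 𝓘(ℝ, E) : M → Type _) x).baseSet)
    (u : TangentSpace 𝓘(ℝ, E) y) : u = ∑ i, coordCoframe x i y u • coordField x i y := by
  set e := trivializationAt E (TangentSpace 𝓘(ℝ, E) : M → Type _) x
  have h1 (i) : coordField x i y = e.symmL ℝ y (Module.finBasis ℝ E i) := by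
    rw [e.symmL_apply hy]
    exact congrArg (e.symm y) (triv_self x _)
  simp_rw [h1, coordCoframe_apply hy, ← map_smul, ← map_sum, (Module.finBasis ℝ E).sum_repr]
  rw [e.symmL_apply hy]
  exact (e.symm_apply_apply_mk hy u).symm

variable (g : ContMDiffRiemannianMetric 𝓘(ℝ, E) ∞ E (TangentSpace 𝓘(ℝ, E) : M → Type _))

theorem contMDiff_inner {X Y : ∀ x : M, TangentSpace 𝓘(ℝ, E) x} (hX : CMDiff ∞ (T% X))
    (hY : CMDiff ∞ (T% Y)) :
    ContMDiff 𝓘(ℝ, E) 𝓘(ℝ, ℝ) ∞ (fun x ↦ g.inner x (X x) (Y x)) := by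
  have h1 : ContMDiff 𝓘(ℝ, E) (𝓘(ℝ, E).prod 𝓘(ℝ, ℝ)) ∞
      (fun x : M ↦ TotalSpace.mk' ℝ (E := Bundle.Trivial M ℝ) x (g.inner x (X x) (Y x))) := by
    apply ContMDiff.clm_bundle_apply₂ (F₁ := E) (F₂ := E)
    · exact g.contMDiff
    · exact hX
    · exact hY
  intro q
  exact ((contMDiffAt_totalSpace ..).1 (h1 q)).2

theorem inner_sharp_apply (x : M) (η : TangentSpace 𝓘(ℝ, E) x →L[ℝ] ℝ)
    (w : TangentSpace 𝓘(ℝ, E) x) : g.inner x (sharp g x η) w = η w := by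
  rw [inner_sharp]

theorem contMDiffAt_det {n : ℕ} {G : M → Matrix (Fin n) (Fin n) ℝ} {x : M}
    (hG : ∀ i j, ContMDiffAt 𝓘(ℝ, E) 𝓘(ℝ, ℝ) ∞ (fun y ↦ G y i j) x) :
    ContMDiffAt 𝓘(ℝ, E) 𝓘(ℝ, ℝ) ∞ (fun y ↦ (G y).det) x := by
  simp_rw [Matrix.det_apply']
  refine contMDiffAt_finsetSum fun σ _ ↦ contMDiffAt_const.mul ?_
  exact contMDiffAt_finsetProd fun i _ ↦ hG _ _

/-- Cramer's rule: each entry is a quotient of determinants, which are polynomial in the entries of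
`G`. -/
theorem contMDiffAt_matrix_inv {n : ℕ} {G : M → Matrix (Fin n) (Fin n) ℝ} {x : M}
    (hG : ∀ i j, ContMDiffAt 𝓘(ℝ, E) 𝓘(ℝ, ℝ) ∞ (fun y ↦ G y i j) x) (h0 : (G x).det ≠ 0)
    (i j : Fin n) : ContMDiffAt 𝓘(ℝ, E) 𝓘(ℝ, ℝ) ∞ (fun y ↦ (G y)⁻¹ i j) x := by
  simp_rw [Matrix.inv_def, Matrix.smul_apply, smul_eq_mul, Ring.inverse_eq_inv',
    Matrix.adjugate_apply]
  refine (ContMDiffAt.inv₀ (contMDiffAt_det hG) h0).mul (contMDiffAt_det fun k l ↦ ?_)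
  by_cases hk : k = j
  · subst hk
    simp only [Matrix.updateRow_self]
    exact contMDiffAt_const
  · simp only [Matrix.updateRow_ne hk]
    exact hG k l

/-- Raising the index of a smooth 1-form gives a smooth vector field. -/
theorem contMDiffAt_sharp [T2Space M] {η : ∀ x : M, TangentSpace 𝓘(ℝ, E) x →L[ℝ] ℝ} {x : M}
    (hη : ∀ X : ∀ x : M, TangentSpace 𝓘(ℝ, E) x, CMDiff ∞ (T% X) →
      ContMDiffAt 𝓘(ℝ, E) 𝓘(ℝ, ℝ) ∞ (fun x ↦ η x (X x)) x) :
    CMDiffAt ∞ (T% (fun x ↦ sharp g x (η x))) x := by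
  obtain ⟨W, hW, hWx⟩ := exists_contMDiff_eq_coordField (E := E) x
  let G (y : M) : Matrix (Fin (Module.finrank ℝ E)) (Fin (Module.finrank ℝ E)) ℝ :=
    Matrix.of fun i j ↦ g.inner y (W i y) (W j y)
  have hG (i j) : ContMDiff 𝓘(ℝ, E) 𝓘(ℝ, ℝ) ∞ (fun y ↦ G y i j) :=
    contMDiff_inner g (hW i) (hW j)
  -- A null vector `c` of the Gram matrix would give a combination `∑ c_i ∂_i` orthogonal to every
  -- `∂_j`, hence of norm zero.
  have hdet : (G x).det ≠ 0 := by
    intro h0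
    obtain ⟨c, hc, hc0⟩ := Matrix.exists_vecMul_eq_zero_iff.2 h0
    have h1 : ∑ i, c i • W i x = 0 := by
      by_contra h
      have h2 := g.pos x _ h
      refine h2.ne' ?_
      conv_lhs => rw [map_sum]
      refine Finset.sum_eq_zero fun j _ ↦ ?_
      have h3 := congrFun hc0 j
      simp only [Matrix.vecMul, dotProduct, G, Matrix.of_apply, Pi.zero_apply] at h3
      simp only [map_sum, map_smul, sum_apply, smul_apply, smul_eq_mul, h3, mul_zero]
    simp_rw [hWx.self_of_nhds, coordField_self] at h1
    refine hc (funext fun i ↦ ?_)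
    exact Fintype.linearIndependent_iff.1 (Module.finBasis ℝ E).linearIndependent c h1 i
  -- The components `c` of the raised form in the frame solve the linear system `c G = (η(W_j))_j`.
  have hev : ∀ᶠ y in 𝓝 x, sharp g y (η y) =
      ∑ i, (∑ j, η y (W j y) * (G y)⁻¹ j i) • W i y := by
    have hb := (trivializationAt E (TangentSpace 𝓘(ℝ, E) : M → Type _) x).open_baseSet.mem_nhds
      (FiberBundle.mem_baseSet_trivializationAt' x)
    have hd : ∀ᶠ y in 𝓝 x, (G y).det ≠ 0 :=
      (contMDiffAt_det fun i j ↦ (hG i j x)).continuousAt.eventually_ne hdet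
    filter_upwards [hWx, hb, hd] with y hy hyb hyd
    have hc := sum_coordField hyb (sharp g y (η y))
    set c := fun i ↦ coordCoframe x i y (sharp g y (η y)) with hcdef
    change _ = ∑ i, c i • _ at hc
    simp only [← hy] at hc
    have h1 : Matrix.vecMul c (G y) = fun j ↦ η y (W j y) := by
      funext j
      rw [← inner_sharp_apply g y]
      conv_rhs => rw [hc]
      simp [Matrix.vecMul, dotProduct, G]
    have h2 : c = Matrix.vecMul (fun j ↦ η y (W j y)) (G y)⁻¹ := by
      rw [← h1, Matrix.vecMul_vecMul, Matrix.mul_nonsing_inv _ (isUnit_iff_ne_zero.2 hyd),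
        Matrix.vecMul_one]
    rw [h2] at hc
    refine hc.trans ?_
    rfl
  have hs : CMDiffAt ∞ (T% (fun y ↦ ∑ i, (∑ j, η y (W j y) * (G y)⁻¹ j i) • W i y)) x := by
    refine ContMDiffAt.sum_section fun i _ ↦ ContMDiffAt.smul_section ?_ (hW i x)
    refine contMDiffAt_finsetSum fun j _ ↦ (hη _ (hW j)).mul ?_
    exact contMDiffAt_matrix_inv (fun i j ↦ hG i j x) hdet j i
  refine hs.congr_of_eventuallyEq ?_
  filter_upwards [hev] with y hy
  rw [hy]

end Metric

/-- Fermat's criterion in a chart; it serves to differentiate `α`. -/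
theorem mvfderiv_eq_zero_of_isLocalMin {E : Type*} [NormedAddCommGroup E] [NormedSpace ℝ E]
    [FiniteDimensional ℝ E] {H : Type*} [TopologicalSpace H] {I : ModelWithCorners ℝ E H}
    [I.Boundaryless] {N : Type*} [TopologicalSpace N] [ChartedSpace H N] [IsManifold I ∞ N]
    {φ : N → ℝ} {x : N} (hφ : MDifferentiableAt I 𝓘(ℝ, ℝ) φ x) (h : IsLocalMin φ x)
    (u : TangentSpace I x) : mvfderiv I φ x u = 0 := by
  rw [mvfderiv_eq_fderiv_comp_extChartAt (mem_extChartAt_source x) hφ]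
  have h1 : IsLocalMin (φ ∘ (extChartAt I x).symm) (extChartAt I x x) := by
    have h2 := (continuousAt_extChartAt_symm (I := I) x).tendsto
    rw [extChartAt_to_inv] at h2
    have h3 := h2.eventually h
    filter_upwards [h3] with y hy
    simpa only [Function.comp_apply, extChartAt_to_inv] using hy
  rw [h1.fderiv_eq_zero]
  rfl

/-! ### The Levi-Civita connection of the base and the differential of `α`. -/

section LeviCivita

variable {E : Type*} [NormedAddCommGroup E] [NormedSpace ℝ E] [FiniteDimensional ℝ E]
  {M : Type*} [TopologicalSpace M] [ChartedSpace E M] [IsManifold 𝓘(ℝ, E) ∞ M]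
  {g : ContMDiffRiemannianMetric 𝓘(ℝ, E) ∞ E (TangentSpace 𝓘(ℝ, E) : M → Type _)}
  {D : CovariantDerivative 𝓘(ℝ, E) E (TangentSpace 𝓘(ℝ, E) : M → Type _)}

theorem contMDiff_nabla {G : ∀ x : M, TangentSpace 𝓘(ℝ, E) x → TangentSpace 𝓘(ℝ, E) x → ℝ}
    (hD : IsLeviCivita G D)
    {X Y : ∀ x : M, TangentSpace 𝓘(ℝ, E) x} (hX : CMDiff ∞ (T% X)) (hY : CMDiff ∞ (T% Y)) :
    CMDiff ∞ (T% (nabla D X Y)) := by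
  have h1 := hD.smooth.contMDiff.contMDiff (σ := Y) hY.contMDiffOn
  rw [contMDiffOn_univ] at h1
  exact ContMDiff.clm_bundle_apply (F₁ := E) (F₂ := E) h1 hX

theorem IsLeviCivita.mlieBracket_eq {H : Type*} [TopologicalSpace H] {I : ModelWithCorners ℝ E H}
    {N : Type*} [TopologicalSpace N] [ChartedSpace H N] [IsManifold I ∞ N]
    {G : ∀ x : N, TangentSpace I x → TangentSpace I x → ℝ}
    {D : CovariantDerivative I E (TangentSpace I : N → Type _)} (hD : IsLeviCivita G D)
    {X Y : ∀ x : N, TangentSpace I x} {x : N} (hX : MDiffAt (T% X) x) (hY : MDiffAt (T% Y) x) :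
    VectorField.mlieBracket I X Y x = D Y x (X x) - D X x (Y x) := by
  have h := D.torsion_apply hX hY
  rw [hD.torsion_free] at h
  have h1 : D Y x (X x) - D X x (Y x) - VectorField.mlieBracket I X Y x = 0 := by
    rw [← h]
    rfl
  exact (sub_eq_zero.1 h1).symm

theorem D_congr {X Y : ∀ x : M, TangentSpace 𝓘(ℝ, E) x} {x : M} (hX : MDiffAt (T% X) x)
    (h : ∀ᶠ y in 𝓝 x, X y = Y y) : D X x = D Y x := by
  refine D.isCovariantDerivativeOnUniv.congr_of_eventuallyEq hX ?_ Filter.univ_mem h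
  refine hX.congr_of_eventuallyEq ?_
  filter_upwards [h] with y hy
  rw [hy]

theorem cometric_eq_inner (x : M) (η ζ : TangentSpace 𝓘(ℝ, E) x →L[ℝ] ℝ) :
    cometric g x η ζ = g.inner x (sharp g x η) (sharp g x ζ) :=
  (inner_sharp_apply g x η _).symm

theorem cometric_comm (x : M) (η ζ : TangentSpace 𝓘(ℝ, E) x →L[ℝ] ℝ) :
    cometric g x η ζ = cometric g x ζ η := by
  rw [cometric_eq_inner, cometric_eq_inner, g.symm]

theorem inner_self_nonneg (x : M) (v : TangentSpace 𝓘(ℝ, E) x) : 0 ≤ g.inner x v v := by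
  by_cases h : v = 0
  · simp [h]
  · exact (g.pos x v h).le

theorem alpha_pos (q : Cotangent E M) : 0 < alpha g q := by
  have h := inner_self_nonneg (g := g) q.1 (sharp g q.1 q.2)
  rw [← cometric_eq_inner] at h
  unfold alpha
  linarith

/-- Near `p`, `α` is the polynomial `1 + ∑ q(S_i) q(∂_i)` in evaluation functions, with `S_i` the
raised coordinate coframe. -/
theorem contMDiff_alpha [T2Space M] : ContMDiff (cotModel E) 𝓘(ℝ, ℝ) ∞ (alpha g) := by
  intro p
  let S (i : Fin (Module.finrank ℝ E)) (y : M) : TangentSpace 𝓘(ℝ, E) y :=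
    sharp g y (coordCoframe p.1 i y)
  have hS (i) : CMDiffAt ∞ (T% (S i)) p.1 :=
    contMDiffAt_sharp g fun X hX ↦ contMDiffAt_coordCoframe_apply p.1 i (hX p.1)
  have h1 : ContMDiffAt (cotModel E) 𝓘(ℝ, ℝ) ∞
      (fun q : Cotangent E M ↦ 1 + ∑ i, evalField (S i) q * evalField (coordField p.1 i) q) p := by
    refine contMDiffAt_const.add (contMDiffAt_finsetSum fun i _ ↦ ?_)
    refine (contMDiffAt_evalField (hS i)).mul (contMDiffAt_evalField ?_)
    exact FiberBundle.contMDiffAt_extend ..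
  refine h1.congr_of_eventuallyEq ?_
  have hb : ∀ᶠ q : Cotangent E M in 𝓝 p, q.1 ∈
      (trivializationAt E (TangentSpace 𝓘(ℝ, E) : M → Type _) p.1).baseSet :=
    (FiberBundle.continuous_proj _ _).continuousAt.eventually
      ((trivializationAt E (TangentSpace 𝓘(ℝ, E) : M → Type _) p.1).open_baseSet.mem_nhds
        (FiberBundle.mem_baseSet_trivializationAt' p.1))
  filter_upwards [hb] with q hq
  rw [alpha, cometric]
  congr 1
  conv_lhs => rw [sum_coordField hq (sharp g q.1 q.2)]
  rw [map_sum]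
  refine Finset.sum_congr rfl fun i _ ↦ ?_
  have h2 : evalField (S i) q = coordCoframe p.1 i q.1 (sharp g q.1 q.2) :=
    cometric_comm (g := g) q.1 q.2 _
  rw [map_smul, h2]
  rfl

/-- Completing the square avoids differentiating `g^{ij}`. Extend the raised covector `q^♯` to a
field `Z`. The function `α - 2 q(Z) + g(Z, Z) = 1 + |q^♯ - Z|²` is minimal at the given point, so
its differential vanishes there. In the derivatives of the last two terms on the left the
contributions of `∇Z` cancel by metric compatibility, which leaves twice the value of the vertical
part on `Z`. -/
theorem mvfderiv_alpha [T2Space M] (hD : IsLeviCivita (fun x v w ↦ g.inner x v w) D)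
    (q : Cotangent E M) (u : TangentSpace (cotModel E) q) :
    mvfderiv (cotModel E) (alpha g) q u = 2 * cometric g q.1 (verPart D q u) q.2 := by
  obtain ⟨Z, hZ, hZq⟩ := exists_contMDiff_eq_extend (I := 𝓘(ℝ, E)) (F := E)
    (sharp g q.1 q.2)
  have hZ0 : Z q.1 = sharp g q.1 q.2 := by
    rw [hZq.self_of_nhds, FiberBundle.extend_apply_self]
  have hZm : MDiffAt (T% Z) q.1 := hZ.mdifferentiableAt (by simp)
  have hI : MDifferentiableAt 𝓘(ℝ, E) 𝓘(ℝ, ℝ) (fun x ↦ g.inner x (Z x) (Z x)) q.1 :=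
    (contMDiff_inner g hZ hZ).mdifferentiableAt (by simp)
  have hα : MDifferentiableAt (cotModel E) 𝓘(ℝ, ℝ) (alpha g) q :=
    contMDiff_alpha.mdifferentiableAt (by simp)
  have hE := mdifferentiableAt_evalField hZm
  have hI' := mdifferentiableAt_comp_proj hI
  let F (q : Cotangent E M) : ℝ :=
    alpha g q - (evalField Z q + evalField Z q) + g.inner q.1 (Z q.1) (Z q.1)
  have hF (q : Cotangent E M) :
      F q = 1 + g.inner q.1 (sharp g q.1 q.2 - Z q.1) (sharp g q.1 q.2 - Z q.1) := by
    have h1 := inner_sharp_apply g q.1 q.2 (Z q.1)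
    have h2 := g.symm q.1 (sharp g q.1 q.2) (Z q.1)
    simp only [F, alpha, cometric_eq_inner, evalField, map_sub, sub_apply]
    linarith
  have hmin : IsLocalMin F q := by
    refine Filter.Eventually.of_forall fun y ↦ ?_
    change F q ≤ F y
    rw [hF, hF, hZ0]
    have h := inner_self_nonneg (g := g) y.1 (sharp g y.1 y.2 - Z y.1)
    rw [sub_self, map_zero]
    simpa only [zero_apply, add_zero, le_add_iff_nonneg_right] using h
  have hFd := mvfderiv_eq_zero_of_isLocalMin
    (MDifferentiableAt.add (MDifferentiableAt.sub hα (MDifferentiableAt.add hE hE)) hI') hmin u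
  have h3 : mvfderiv (cotModel E) F q = mvfderiv (cotModel E) (alpha g) q
      - (mvfderiv (cotModel E) (evalField Z) q + mvfderiv (cotModel E) (evalField Z) q)
      + mvfderiv (cotModel E) (fun q : Cotangent E M ↦ g.inner q.1 (Z q.1) (Z q.1)) q := by
    rw [← mvfderiv_add hE hE, ← mvfderiv_sub hα (MDifferentiableAt.add hE hE),
      ← mvfderiv_add (MDifferentiableAt.sub hα (MDifferentiableAt.add hE hE)) hI']
    rfl
  have h4 : mvfderiv (cotModel E) F q u = 0 := hFd
  have h5 := hD.metric Z Z q.1 hZm hZm (horPart q u)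
  have h6 := mvfderiv_comp_proj hI u
  rw [h3] at h4
  simp only [add_apply, sub_apply, mvfderiv_evalField D hZm, h6, h5] at h4
  have h7 := inner_sharp_apply g q.1 q.2 (D Z q.1 (horPart q u))
  rw [← hZ0] at h7
  have h8 := g.symm q.1 (Z q.1) (D Z q.1 (horPart q u))
  rw [cometric, ← hZ0]
  linarith

end LeviCivita

/-! ### Tangent vectors are separated by functions. -/

section Separation

variable {E : Type*} [NormedAddCommGroup E] [NormedSpace ℝ E] [FiniteDimensional ℝ E]
  {H : Type*} [TopologicalSpace H] {I : ModelWithCorners ℝ E H}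
  {N : Type*} [TopologicalSpace N] [ChartedSpace H N] [IsManifold I ∞ N]

theorem mfderiv_clm_comp_extChartAt {F : Type*} [NormedAddCommGroup F] [NormedSpace ℝ F]
    (A : E →L[ℝ] F) {x y : N} (hy : y ∈ (extChartAt I x).source) (u : TangentSpace I y) :
    mfderiv I 𝓘(ℝ, F) (A ∘ extChartAt I x) y u = A (mfderiv I 𝓘(ℝ, E) (extChartAt I x) y u) := by
  have he : MDifferentiableAt I 𝓘(ℝ, E) (extChartAt I x) y :=
    mdifferentiableAt_extChartAt (by simpa using hy)
  refine (mfderiv_comp_apply y A.mdifferentiableAt he u).trans ?_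
  rw [A.mfderiv_eq]
  rfl

theorem mvfderiv_congr {φ ψ : N → ℝ} {x : N} (h : φ =ᶠ[𝓝 x] ψ) : mvfderiv I φ x = mvfderiv I ψ x := by
  rw [mvfderiv, mvfderiv, h.mfderiv_eq]
  rfl

/-- A tangent vector is determined by the derivatives of functions along it. -/
theorem eq_of_mvfderiv_eq {x : N} {u v : TangentSpace I x}
    (h : ∀ φ : N → ℝ, ContMDiffAt I 𝓘(ℝ, ℝ) 2 φ x → mvfderiv I φ x u = mvfderiv I φ x v) :
    u = v := by
  refine (Module.finBasis ℝ E).ext_elem_iff.2 fun i ↦ ?_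
  let A : E →L[ℝ] ℝ := ((Module.finBasis ℝ E).coord i).toContinuousLinearMap
  have : IsManifold I 2 N := IsManifold.of_le (n := ∞) (by norm_cast)
  have hA : ContMDiffAt I 𝓘(ℝ, ℝ) 2 (A ∘ extChartAt I x) x :=
    A.contDiff.contDiffAt.comp_contMDiffAt contMDiffAt_extChartAt
  have h1 : mfderiv I 𝓘(ℝ, ℝ) (A ∘ extChartAt I x) x u = mfderiv I 𝓘(ℝ, ℝ) (A ∘ extChartAt I x) x v :=
    h _ hA
  rw [mfderiv_clm_comp_extChartAt A (mem_extChartAt_source x),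
    mfderiv_clm_comp_extChartAt A (mem_extChartAt_source x), mfderiv_extChartAt_self] at h1
  exact h1

end Separation

/-! ### Differentiability of horizontal and vertical lifts. -/

section Lifts

variable {E : Type*} [NormedAddCommGroup E] [NormedSpace ℝ E] [FiniteDimensional ℝ E]
  {M : Type*} [TopologicalSpace M] [ChartedSpace E M] [IsManifold 𝓘(ℝ, E) ∞ M] [T2Space M]

theorem evalField_coordField_eq {p q : Cotangent E M} (hq : q.1 ∈ (chartAt E p.1).source)
    (i : Fin (Module.finrank ℝ E)) :
    evalField (coordField p.1 i) q = (extChartAt (cotModel E) p q).2 (Module.finBasis ℝ E i) := by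
  rw [cot_chart]
  refine Eq.trans ?_ (inCoord_apply _ _ (by simpa using hq) _ _).symm
  exact congrArg (fun v ↦ q.2 (Trivialization.symm _ q.1 v)) (triv_self p.1 _)

/-- The induced chart of `T*M` consists of base coordinates and the functions `q(∂_i)`. Hence the
components of `U` in it are those of its projection together with the derivatives of `q(∂_i)` along
`U`. -/
theorem mdifferentiableAt_cotangentField {U : ∀ q : Cotangent E M, TangentSpace (cotModel E) q}
    {p : Cotangent E M}
    (h1 : MDifferentiableAt (cotModel E) 𝓘(ℝ, E) (fun q : Cotangent E M ↦
      mfderiv 𝓘(ℝ, E) 𝓘(ℝ, E) (extChartAt 𝓘(ℝ, E) p.1) q.1 (horPart q (U q))) p)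
    (h2 : ∀ W : ∀ x : M, TangentSpace 𝓘(ℝ, E) x, CMDiff ∞ (T% W) →
      MDifferentiableAt (cotModel E) 𝓘(ℝ, ℝ)
        (fun q ↦ mvfderiv (cotModel E) (evalField W) q (U q)) p) :
    MDifferentiableAt (cotModel E) (cotModel E).tangent
      (fun q ↦ (⟨q, U q⟩ : TangentBundle (cotModel E) (Cotangent E M))) p := by
  let L (q : Cotangent E M) : E × (E →L[ℝ] ℝ) :=
    mfderiv (cotModel E) 𝓘(ℝ, E × (E →L[ℝ] ℝ)) (extChartAt (cotModel E) p) q (U q)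
  have hbase : ∀ q ∈ (extChartAt (cotModel E) p).source, q.1 ∈ (chartAt E p.1).source := by
    intro q hq
    rw [FiberBundle.extChartAt] at hq
    simp at hq
    exact hq.1
  have hL1 : ∀ᶠ q in 𝓝 p, (L q).1 =
      mfderiv 𝓘(ℝ, E) 𝓘(ℝ, E) (extChartAt 𝓘(ℝ, E) p.1) q.1 (horPart q (U q)) := by
    filter_upwards [extChartAt_source_mem_nhds (I := cotModel E) p] with q hq
    have h3 := mfderiv_clm_comp_extChartAt (ContinuousLinearMap.fst ℝ E (E →L[ℝ] ℝ)) hq (U q)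
    have h4 : (ContinuousLinearMap.fst ℝ E (E →L[ℝ] ℝ)) ∘ extChartAt (cotModel E) p =
        extChartAt 𝓘(ℝ, E) p.1 ∘ (TotalSpace.proj : Cotangent E M → M) := by
      funext y
      exact congrArg Prod.fst (cot_chart p y)
    have h5 : MDifferentiableAt 𝓘(ℝ, E) 𝓘(ℝ, E) (extChartAt 𝓘(ℝ, E) p.1) q.1 :=
      mdifferentiableAt_extChartAt (hbase q hq)
    refine h3.symm.trans ?_
    rw [h4, horPart_eq_mfderiv]
    exact mfderiv_comp_apply q h5 (contMDiff_proj.mdifferentiableAt (by simp)) (U q)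
  have hL2 (i : Fin (Module.finrank ℝ E)) : ∀ᶠ q in 𝓝 p, (L q).2 (Module.finBasis ℝ E i) =
      mvfderiv (cotModel E) (evalField (coordField p.1 i)) q (U q) := by
    filter_upwards [extChartAt_source_mem_nhds (I := cotModel E) p] with q hq
    have h3 := mfderiv_clm_comp_extChartAt
      ((ContinuousLinearMap.apply ℝ ℝ (Module.finBasis ℝ E i)).comp
         (ContinuousLinearMap.snd ℝ E (E →L[ℝ] ℝ))) hq (U q)
    refine h3.symm.trans ?_
    refine congrArg (fun A : TangentSpace (cotModel E) q →L[ℝ] ℝ ↦ A (U q)) ?_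
    refine Filter.EventuallyEq.mfderiv_eq ?_
    filter_upwards [(isOpen_extChartAt_source p).mem_nhds hq] with y hy
    exact (evalField_coordField_eq (hbase y hy) i).symm
  -- The second hypothesis speaks of globally smooth fields, so the coordinate fields are replaced
  -- by such fields with the same germs.
  obtain ⟨W, hW, hWx⟩ := exists_contMDiff_eq_coordField (E := E) p.1
  have hW2 (i : Fin (Module.finrank ℝ E)) : ∀ᶠ q : Cotangent E M in 𝓝 p,
      mvfderiv (cotModel E) (evalField (coordField p.1 i)) q (U q) =
        mvfderiv (cotModel E) (evalField (W i)) q (U q) := by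
    have h3 : ∀ᶠ q : Cotangent E M in 𝓝 p, evalField (coordField p.1 i) q = evalField (W i) q := by
      filter_upwards [(FiberBundle.continuous_proj (E →L[ℝ] ℝ)
        (fun x : M ↦ TangentSpace 𝓘(ℝ, E) x →L[ℝ] ℝ)).continuousAt.eventually hWx] with q hq
      exact congrArg q.2 (hq i).symm
    filter_upwards [h3.eventually_nhds] with q hq
    rw [mvfderiv_congr hq]
  refine mdifferentiableAt_vectorField_iff.2 ?_
  change MDifferentiableAt (cotModel E) 𝓘(ℝ, E × (E →L[ℝ] ℝ)) (fun q ↦ ((L q).1, (L q).2)) p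
  refine MDifferentiableAt.prodMk_space (h1.congr_of_eventuallyEq hL1) ?_
  refine mdifferentiableAt_dual_of_apply_basis (Module.finBasis ℝ E) fun i ↦ ?_
  exact (h2 (W i) (hW i)).congr_of_eventuallyEq (Filter.EventuallyEq.trans (hL2 i) (hW2 i))

/-- The smoothness of a 1-form, tested on smooth vector fields. -/
def IsSmoothForm (η : ∀ x : M, TangentSpace 𝓘(ℝ, E) x →L[ℝ] ℝ) : Prop :=
  ∀ X : ∀ x : M, TangentSpace 𝓘(ℝ, E) x, CMDiff ∞ (T% X) →
    ContMDiff 𝓘(ℝ, E) 𝓘(ℝ, ℝ) ∞ (fun x ↦ η x (X x))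

theorem mdifferentiableAt_vertLift {η : ∀ x : M, TangentSpace 𝓘(ℝ, E) x →L[ℝ] ℝ}
    (hη : IsSmoothForm η) (D : CovariantDerivative 𝓘(ℝ, E) E (TangentSpace 𝓘(ℝ, E) : M → Type _))
    (p : Cotangent E M) :
    MDifferentiableAt (cotModel E) (cotModel E).tangent
      (fun q ↦ (⟨q, vertLift η q⟩ : TangentBundle (cotModel E) (Cotangent E M))) p := by
  refine mdifferentiableAt_cotangentField ?_ fun W hW ↦ ?_
  · refine (mdifferentiableAt_const (c := (0 : E))).congr_of_eventuallyEq ?_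
    refine Filter.Eventually.of_forall fun q ↦ ?_
    exact map_zero _
  · have h1 := mdifferentiableAt_comp_proj (q := p) ((hη W hW).mdifferentiableAt (by simp))
    refine h1.congr_of_eventuallyEq (Filter.Eventually.of_forall fun q ↦ ?_)
    exact mvfderiv_evalField_vlift D (hW.mdifferentiableAt (by simp)) _

variable {g : ContMDiffRiemannianMetric 𝓘(ℝ, E) ∞ E (TangentSpace 𝓘(ℝ, E) : M → Type _)}
  {D : CovariantDerivative 𝓘(ℝ, E) E (TangentSpace 𝓘(ℝ, E) : M → Type _)}

theorem mdifferentiableAt_horLift (hD : IsLeviCivita (fun x v w ↦ g.inner x v w) D)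
    {X : ∀ x : M, TangentSpace 𝓘(ℝ, E) x} (hX : CMDiff ∞ (T% X)) (p : Cotangent E M) :
    MDifferentiableAt (cotModel E) (cotModel E).tangent
      (fun q ↦ (⟨q, horLift D X q⟩ : TangentBundle (cotModel E) (Cotangent E M))) p := by
  refine mdifferentiableAt_cotangentField ?_ fun W hW ↦ ?_
  · have h1 := mdifferentiableAt_vectorField_iff.1 (hX.mdifferentiableAt (x := p.1) (by simp))
    exact MDifferentiableAt.comp p h1 (contMDiff_proj.mdifferentiableAt (by simp))
  · have h1 := mdifferentiableAt_evalField (q := p)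
      ((contMDiff_nabla hD hX hW).mdifferentiableAt (by simp))
    refine h1.congr_of_eventuallyEq (Filter.Eventually.of_forall fun q ↦ ?_)
    exact mvfderiv_evalField_hlift D (hW.mdifferentiableAt (by simp)) _

end Lifts

/-! ### Lie brackets of lifts. -/

section Brackets

variable {E : Type*} [NormedAddCommGroup E] [NormedSpace ℝ E] [FiniteDimensional ℝ E]
  {M : Type*} [TopologicalSpace M] [ChartedSpace E M] [IsManifold 𝓘(ℝ, E) ∞ M] [T2Space M]
  {g : ContMDiffRiemannianMetric 𝓘(ℝ, E) ∞ E (TangentSpace 𝓘(ℝ, E) : M → Type _)}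
  {D : CovariantDerivative 𝓘(ℝ, E) E (TangentSpace 𝓘(ℝ, E) : M → Type _)}

theorem covector_ext_smooth {x : M} {η ζ : TangentSpace 𝓘(ℝ, E) x →L[ℝ] ℝ}
    (h : ∀ W : ∀ x : M, TangentSpace 𝓘(ℝ, E) x, CMDiff ∞ (T% W) → η (W x) = ζ (W x)) : η = ζ := by
  obtain ⟨W, hW, hWx⟩ := exists_contMDiff_eq_coordField (E := E) x
  refine covector_ext fun i ↦ ?_
  rw [← hWx.self_of_nhds i, h _ (hW i)]

theorem eventually_mvfderiv_comp_proj {φ : M → ℝ} {p : Cotangent E M}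
    (hφ : ContMDiffAt 𝓘(ℝ, E) 𝓘(ℝ, ℝ) 2 φ p.1)
    (U : ∀ q : Cotangent E M, TangentSpace (cotModel E) q) :
    (fun q ↦ mvfderiv (cotModel E) (fun q : Cotangent E M ↦ φ q.1) q (U q)) =ᶠ[𝓝 p]
      fun q ↦ mvfderiv 𝓘(ℝ, E) φ q.1 (horPart q (U q)) := by
  have : IsManifold 𝓘(ℝ, E) 2 M := IsManifold.of_le (n := ∞) (by norm_cast)
  have h1 : ∀ᶠ y in 𝓝 p.1, ContMDiffAt 𝓘(ℝ, E) 𝓘(ℝ, ℝ) 2 φ y :=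
    (contMDiffAt_iff_contMDiffAt_nhds (by simp)).1 hφ
  filter_upwards [(FiberBundle.continuous_proj (E →L[ℝ] ℝ)
    (fun x : M ↦ TangentSpace 𝓘(ℝ, E) x →L[ℝ] ℝ)).continuousAt.eventually h1] with q hq
  exact mvfderiv_comp_proj (hq.mdifferentiableAt (by norm_num)) _

theorem mvfderiv_mlieBracket_comp_proj {φ : M → ℝ} {p : Cotangent E M}
    (hφ : ContMDiffAt 𝓘(ℝ, E) 𝓘(ℝ, ℝ) 2 φ p.1)
    {U V : ∀ q : Cotangent E M, TangentSpace (cotModel E) q}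
    (hU : MDifferentiableAt (cotModel E) (cotModel E).tangent
      (fun q ↦ (⟨q, U q⟩ : TangentBundle (cotModel E) (Cotangent E M))) p)
    (hV : MDifferentiableAt (cotModel E) (cotModel E).tangent
      (fun q ↦ (⟨q, V q⟩ : TangentBundle (cotModel E) (Cotangent E M))) p) :
    mvfderiv 𝓘(ℝ, E) φ p.1 (horPart p (VectorField.mlieBracket (cotModel E) U V p)) =
      mvfderiv (cotModel E) (fun q : Cotangent E M ↦
          mvfderiv 𝓘(ℝ, E) φ q.1 (horPart q (V q))) p (U p) -
        mvfderiv (cotModel E) (fun q : Cotangent E M ↦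
          mvfderiv 𝓘(ℝ, E) φ q.1 (horPart q (U q))) p (V p) := by
  have h1 : ContMDiffAt (cotModel E) 𝓘(ℝ, ℝ) 2 (fun q : Cotangent E M ↦ φ q.1) p :=
    ContMDiffAt.comp p hφ (contMDiff_proj.contMDiffAt.of_le (by norm_cast))
  rw [← mvfderiv_comp_proj (hφ.mdifferentiableAt (by norm_num)), mvfderiv_mlieBracket h1 hU hV,
    mvfderiv_congr (eventually_mvfderiv_comp_proj hφ U),
    mvfderiv_congr (eventually_mvfderiv_comp_proj hφ V)]

theorem mvfderiv_comp_proj_vlift {φ : M → ℝ} {p : Cotangent E M}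
    (hφ : MDifferentiableAt 𝓘(ℝ, E) 𝓘(ℝ, ℝ) φ p.1) (η : TangentSpace 𝓘(ℝ, E) p.1 →L[ℝ] ℝ) :
    mvfderiv (cotModel E) (fun q : Cotangent E M ↦ φ q.1) p (vlift p η) = 0 := by
  rw [mvfderiv_comp_proj hφ, horPart_vlift, map_zero]

theorem mdifferentiableAt_mvfderiv_apply {φ : M → ℝ} {x : M}
    (hφ : ContMDiffAt 𝓘(ℝ, E) 𝓘(ℝ, ℝ) 2 φ x) {X : ∀ x : M, TangentSpace 𝓘(ℝ, E) x}
    (hX : CMDiff ∞ (T% X)) :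
    MDifferentiableAt 𝓘(ℝ, E) 𝓘(ℝ, ℝ) (fun y ↦ mvfderiv 𝓘(ℝ, E) φ y (X y)) x := by
  have : IsManifold 𝓘(ℝ, E) 2 M := IsManifold.of_le (n := ∞) (by norm_cast)
  have hφn : ∀ᶠ y in 𝓝 x, ContMDiffAt 𝓘(ℝ, E) 𝓘(ℝ, ℝ) 2 φ y :=
    (contMDiffAt_iff_contMDiffAt_nhds (by simp)).1 hφ
  have h1 : (fun y ↦ mvfderiv 𝓘(ℝ, E) φ y (X y)) =ᶠ[𝓝 x]
      fun y ↦ fderiv ℝ (φ ∘ (extChartAt 𝓘(ℝ, E) x).symm) (extChartAt 𝓘(ℝ, E) x y)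
        (mfderiv 𝓘(ℝ, E) 𝓘(ℝ, E) (extChartAt 𝓘(ℝ, E) x) y (X y)) := by
    filter_upwards [extChartAt_source_mem_nhds (I := 𝓘(ℝ, E)) x, hφn] with y hy hyφ
    exact mvfderiv_eq_fderiv_comp_extChartAt hy (hyφ.mdifferentiableAt (by norm_num)) _
  have hφ' : ContDiffAt ℝ 2 (φ ∘ (extChartAt 𝓘(ℝ, E) x).symm) (extChartAt 𝓘(ℝ, E) x x) := by
    have h1 := (contMDiffAt_iff_source (I := 𝓘(ℝ, E)) (x := x) (f := φ)).1 hφ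
    rw [(𝓘(ℝ, E)).range_eq_univ, contMDiffWithinAt_univ] at h1
    exact h1.contDiffAt
  have h2 : DifferentiableAt ℝ (fderiv ℝ (φ ∘ (extChartAt 𝓘(ℝ, E) x).symm))
      (extChartAt 𝓘(ℝ, E) x x) :=
    (hφ'.fderiv_right (m := 1) (by norm_num)).differentiableAt (by norm_num)
  have h3 : MDifferentiableAt 𝓘(ℝ, E) 𝓘(ℝ, E →L[ℝ] ℝ)
      (fun y ↦ fderiv ℝ (φ ∘ (extChartAt 𝓘(ℝ, E) x).symm) (extChartAt 𝓘(ℝ, E) x y)) x :=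
    h2.comp_mdifferentiableAt (f := extChartAt 𝓘(ℝ, E) x) (mdifferentiableAt_extChartAt (by simp))
  exact MDifferentiableAt.congr_of_eventuallyEq
    (h3.clm_apply (mdifferentiableAt_vectorField_iff.1 (hX.mdifferentiableAt (by simp)))) h1

/-- Tested on `φ ∘ π`, where `^HX` acts as `X` does on `φ`. -/
theorem horPart_mlieBracket_horLift (hD : IsLeviCivita (fun x v w ↦ g.inner x v w) D)
    {X Y : ∀ x : M, TangentSpace 𝓘(ℝ, E) x} (hX : CMDiff ∞ (T% X)) (hY : CMDiff ∞ (T% Y))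
    (p : Cotangent E M) :
    horPart p (VectorField.mlieBracket (cotModel E) (horLift D X) (horLift D Y) p) =
      VectorField.mlieBracket 𝓘(ℝ, E) X Y p.1 := by
  refine eq_of_mvfderiv_eq fun φ hφ ↦ ?_
  rw [mvfderiv_mlieBracket_comp_proj hφ (mdifferentiableAt_horLift hD hX p)
    (mdifferentiableAt_horLift hD hY p), mvfderiv_mlieBracket hφ
    (hX.mdifferentiableAt (by simp)) (hY.mdifferentiableAt (by simp))]
  exact congrArg₂ (· - ·) (mvfderiv_comp_proj (mdifferentiableAt_mvfderiv_apply hφ hY) _)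
    (mvfderiv_comp_proj (mdifferentiableAt_mvfderiv_apply hφ hX) _)

/-- Both terms of the commutator on `φ ∘ π` vanish: `^Vθ` kills functions pulled back from `M`, and
`^HX (φ ∘ π) = (X φ) ∘ π` is again one. -/
theorem horPart_mlieBracket_horLift_vertLift (hD : IsLeviCivita (fun x v w ↦ g.inner x v w) D)
    {X : ∀ x : M, TangentSpace 𝓘(ℝ, E) x} (hX : CMDiff ∞ (T% X))
    {θ : ∀ x : M, TangentSpace 𝓘(ℝ, E) x →L[ℝ] ℝ} (hθ : IsSmoothForm θ) (p : Cotangent E M) :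
    horPart p (VectorField.mlieBracket (cotModel E) (horLift D X) (vertLift θ) p) = 0 := by
  refine eq_of_mvfderiv_eq fun φ hφ ↦ ?_
  rw [mvfderiv_mlieBracket_comp_proj hφ (mdifferentiableAt_horLift hD hX p)
    (mdifferentiableAt_vertLift hθ D p)]
  have h1 := mvfderiv_comp_proj_vlift (mdifferentiableAt_mvfderiv_apply hφ hX) (θ p.1)
  have h2 : (fun q : Cotangent E M ↦ mvfderiv 𝓘(ℝ, E) φ q.1 (horPart q (vertLift θ q)))
      = fun _ ↦ 0 := funext fun q ↦ map_zero _
  rw [h2, mvfderiv_const, map_zero, zero_apply, zero_sub, neg_eq_zero]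
  exact h1

theorem horPart_mlieBracket_vertLift (D : CovariantDerivative 𝓘(ℝ, E) E
      (TangentSpace 𝓘(ℝ, E) : M → Type _)) {η θ : ∀ x : M, TangentSpace 𝓘(ℝ, E) x →L[ℝ] ℝ}
    (hη : IsSmoothForm η) (hθ : IsSmoothForm θ) (p : Cotangent E M) :
    horPart p (VectorField.mlieBracket (cotModel E) (vertLift η) (vertLift θ) p) = 0 := by
  refine eq_of_mvfderiv_eq fun φ hφ ↦ ?_
  rw [mvfderiv_mlieBracket_comp_proj hφ (mdifferentiableAt_vertLift hη D p)
    (mdifferentiableAt_vertLift hθ D p)]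
  have h2 (θ : ∀ x : M, TangentSpace 𝓘(ℝ, E) x →L[ℝ] ℝ) :
      (fun q : Cotangent E M ↦ mvfderiv 𝓘(ℝ, E) φ q.1 (horPart q (vertLift θ q)))
      = fun _ ↦ 0 := funext fun q ↦ map_zero _
  rw [h2, h2, mvfderiv_const, map_zero, zero_apply, zero_apply, sub_zero]

/-- The commutator on `q(W)`, corrected by the share of the horizontal part in `mvfderiv_evalField`.
-/
theorem verPart_mlieBracket_apply
    {U V : ∀ q : Cotangent E M, TangentSpace (cotModel E) q} {p : Cotangent E M}
    (hU : MDifferentiableAt (cotModel E) (cotModel E).tangent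
      (fun q ↦ (⟨q, U q⟩ : TangentBundle (cotModel E) (Cotangent E M))) p)
    (hV : MDifferentiableAt (cotModel E) (cotModel E).tangent
      (fun q ↦ (⟨q, V q⟩ : TangentBundle (cotModel E) (Cotangent E M))) p)
    {W : ∀ x : M, TangentSpace 𝓘(ℝ, E) x} (hW : CMDiff ∞ (T% W)) :
    verPart D p (VectorField.mlieBracket (cotModel E) U V p) (W p.1) =
      mvfderiv (cotModel E) (fun q ↦ mvfderiv (cotModel E) (evalField W) q (V q)) p (U p)
      - mvfderiv (cotModel E) (fun q ↦ mvfderiv (cotModel E) (evalField W) q (U q)) p (V p)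
      - p.2 (D W p.1 (horPart p (VectorField.mlieBracket (cotModel E) U V p))) := by
  have h1 : ContMDiffAt (cotModel E) 𝓘(ℝ, ℝ) 2 (evalField W) p :=
    (contMDiffAt_evalField (hW p.1)).of_le (by norm_cast)
  have h2 := mvfderiv_evalField D (q := p) (hW.mdifferentiableAt (by simp))
    (VectorField.mlieBracket (cotModel E) U V p)
  rw [mvfderiv_mlieBracket h1 hU hV] at h2
  rw [h2]
  ring

/-- Horizontal lifts preserve the class of evaluation functions, so iterated derivatives of `q(W)`
become iterated covariant derivatives of `W`. -/
theorem mvfderiv_evalField_horLift_eq {X W : ∀ x : M, TangentSpace 𝓘(ℝ, E) x}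
    (hW : CMDiff ∞ (T% W)) :
    (fun q ↦ mvfderiv (cotModel E) (evalField W) q (horLift D X q)) = evalField (nabla D X W) :=
  funext fun _ ↦ mvfderiv_evalField_hlift D (hW.mdifferentiableAt (by simp)) _

theorem mvfderiv_evalField_vertLift_eq (D : CovariantDerivative 𝓘(ℝ, E) E
      (TangentSpace 𝓘(ℝ, E) : M → Type _)) {η : ∀ x : M, TangentSpace 𝓘(ℝ, E) x →L[ℝ] ℝ}
    {W : ∀ x : M, TangentSpace 𝓘(ℝ, E) x} (hW : CMDiff ∞ (T% W)) :
    (fun q ↦ mvfderiv (cotModel E) (evalField W) q (vertLift η q)) =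
      fun q : Cotangent E M ↦ η q.1 (W q.1) :=
  funext fun _ ↦ mvfderiv_evalField_vlift D (hW.mdifferentiableAt (by simp)) _

/-- The vertical component of the bracket of horizontal lifts is the curvature. -/
theorem verPart_mlieBracket_horLift (hD : IsLeviCivita (fun x v w ↦ g.inner x v w) D)
    {X Y W : ∀ x : M, TangentSpace 𝓘(ℝ, E) x} (hX : CMDiff ∞ (T% X)) (hY : CMDiff ∞ (T% Y))
    (hW : CMDiff ∞ (T% W)) (p : Cotangent E M) :
    verPart D p (VectorField.mlieBracket (cotModel E) (horLift D X) (horLift D Y) p) (W p.1) =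
      p.2 (curvature D X Y W p.1) := by
  rw [verPart_mlieBracket_apply (mdifferentiableAt_horLift hD hX p)
    (mdifferentiableAt_horLift hD hY p) hW, horPart_mlieBracket_horLift hD hX hY,
    mvfderiv_evalField_horLift_eq hW, mvfderiv_evalField_horLift_eq hW]
  -- The commutator contributes `p(∇_X ∇_Y W - ∇_Y ∇_X W)`, the horizontal part `[X, Y]` the
  -- remaining `-p(∇_{[X, Y]} W)`.
  have h1 := mvfderiv_evalField_hlift D (q := p)
    ((contMDiff_nabla hD hY hW).mdifferentiableAt (by simp)) (X p.1)
  have h2 := mvfderiv_evalField_hlift D (q := p)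
    ((contMDiff_nabla hD hX hW).mdifferentiableAt (by simp)) (Y p.1)
  rw [horLift, horLift, h1, h2, curvature, map_sub, map_sub]
  rfl

/-- The vertical component of the bracket of horizontal lifts is orthogonal to the Liouville
field. -/
theorem cometric_verPart_mlieBracket_horLift (hD : IsLeviCivita (fun x v w ↦ g.inner x v w) D)
    {X Y : ∀ x : M, TangentSpace 𝓘(ℝ, E) x} (hX : CMDiff ∞ (T% X)) (hY : CMDiff ∞ (T% Y))
    (p : Cotangent E M) :
    cometric g p.1 (verPart D p
      (VectorField.mlieBracket (cotModel E) (horLift D X) (horLift D Y) p)) p.2 = 0 := by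
  have h1 : ContMDiffAt (cotModel E) 𝓘(ℝ, ℝ) 2 (alpha g) p :=
    contMDiff_alpha.contMDiffAt.of_le (by norm_cast)
  have h2 := mvfderiv_mlieBracket h1 (mdifferentiableAt_horLift hD hX p)
    (mdifferentiableAt_horLift hD hY p)
  -- `α` is constant along horizontal lifts, so their bracket kills it too. This replaces an appeal
  -- to the skew symmetry of the curvature.
  have h3 (X : ∀ x : M, TangentSpace 𝓘(ℝ, E) x) :
      (fun q ↦ mvfderiv (cotModel E) (alpha g) q (horLift D X q)) = fun _ ↦ 0 := by
    funext q
    rw [mvfderiv_alpha hD, horLift, verPart_hlift, cometric_zero_left, mul_zero]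
  rw [mvfderiv_alpha hD, h3, h3, mvfderiv_const, zero_apply, zero_apply] at h2
  linarith

theorem verPart_mlieBracket_horLift_vertLift_apply
    (hD : IsLeviCivita (fun x v w ↦ g.inner x v w) D)
    {X W : ∀ x : M, TangentSpace 𝓘(ℝ, E) x} (hX : CMDiff ∞ (T% X)) (hW : CMDiff ∞ (T% W))
    {θ : ∀ x : M, TangentSpace 𝓘(ℝ, E) x →L[ℝ] ℝ} (hθ : IsSmoothForm θ) (p : Cotangent E M) :
    verPart D p (VectorField.mlieBracket (cotModel E) (horLift D X) (vertLift θ) p) (W p.1) =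
      mvfderiv 𝓘(ℝ, E) (fun y ↦ θ y (W y)) p.1 (X p.1) - θ p.1 (D W p.1 (X p.1)) := by
  rw [verPart_mlieBracket_apply (mdifferentiableAt_horLift hD hX p)
    (mdifferentiableAt_vertLift hθ D p) hW, horPart_mlieBracket_horLift_vertLift hD hX hθ,
    mvfderiv_evalField_horLift_eq hW, mvfderiv_evalField_vertLift_eq D hW]
  have h1 := mvfderiv_comp_proj (q := p) ((hθ W hW).mdifferentiableAt (by simp)) (horLift D X p)
  have h2 := mvfderiv_evalField_vlift D (q := p)
    ((contMDiff_nabla hD hX hW).mdifferentiableAt (by simp)) (θ p.1)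
  rw [h1, vertLift, h2, map_zero, map_zero, sub_zero]
  rfl

theorem verPart_mlieBracket_horLift_vertLift (hD : IsLeviCivita (fun x v w ↦ g.inner x v w) D)
    {X : ∀ x : M, TangentSpace 𝓘(ℝ, E) x} (hX : CMDiff ∞ (T% X))
    {θ : ∀ x : M, TangentSpace 𝓘(ℝ, E) x →L[ℝ] ℝ} (hθ : IsSmoothForm θ) (p : Cotangent E M) :
    verPart D p (VectorField.mlieBracket (cotModel E) (horLift D X) (vertLift θ) p) =
      nablaForm D X θ p.1 := by
  obtain ⟨W, hW, hWx⟩ := exists_contMDiff_eq_coordField (E := E) p.1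
  refine covector_ext fun i ↦ ?_
  have h1 : nablaForm D X θ p.1 (coordField p.1 i p.1) =
      mvfderiv 𝓘(ℝ, E) (fun y ↦ θ y (coordField p.1 i y)) p.1 (X p.1)
        - θ p.1 (D (coordField p.1 i) p.1 (X p.1)) := by
    have hc (j) : coordForm p.1 j (coordField p.1 i p.1) = if i = j then 1 else 0 := by
      rw [coordField_self]
      change (Module.finBasis ℝ E).coord j (Module.finBasis ℝ E i) = _
      simp [Finsupp.single_apply]
    simp [nablaForm, hc]
  have h2 : (fun y ↦ θ y (coordField p.1 i y)) =ᶠ[𝓝 p.1] fun y ↦ θ y (W i y) := by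
    filter_upwards [hWx] with y hy
    rw [hy]
  -- `nablaForm` is written with coordinate fields; by locality it may be evaluated with the global
  -- fields `W i`.
  have h3 : D (W i) p.1 = D (coordField p.1 i) p.1 :=
    D_congr ((hW i).mdifferentiableAt (by simp)) (hWx.mono fun y hy ↦ hy i)
  rw [h1, mvfderiv_congr h2, ← h3, ← hWx.self_of_nhds i]
  exact verPart_mlieBracket_horLift_vertLift_apply hD hX (hW i) hθ p

/-- On `q(W)` a vertical lift gives `η(W) ∘ π`, which the other one kills. The connection serves
only to split the tangent space. -/
theorem mlieBracket_vertLift (D : CovariantDerivative 𝓘(ℝ, E) E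
      (TangentSpace 𝓘(ℝ, E) : M → Type _)) {η θ : ∀ x : M, TangentSpace 𝓘(ℝ, E) x →L[ℝ] ℝ}
    (hη : IsSmoothForm η) (hθ : IsSmoothForm θ) (p : Cotangent E M) :
    VectorField.mlieBracket (cotModel E) (vertLift η) (vertLift θ) p = 0 := by
  have h1 : verPart D p (VectorField.mlieBracket (cotModel E) (vertLift η) (vertLift θ) p) = 0 := by
    refine covector_ext_smooth fun W hW ↦ ?_
    rw [verPart_mlieBracket_apply (mdifferentiableAt_vertLift hη D p)
      (mdifferentiableAt_vertLift hθ D p) hW, horPart_mlieBracket_vertLift D hη hθ,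
      mvfderiv_evalField_vertLift_eq D hW, mvfderiv_evalField_vertLift_eq D hW]
    have h2 := mvfderiv_comp_proj_vlift (p := p) ((hθ W hW).mdifferentiableAt (by simp)) (η p.1)
    have h3 := mvfderiv_comp_proj_vlift (p := p) ((hη W hW).mdifferentiableAt (by simp)) (θ p.1)
    rw [vertLift, vertLift, h2, h3]
    simp
  rw [← hlift_add_vlift D p (VectorField.mlieBracket (cotModel E) (vertLift η) (vertLift θ) p), h1,
    horPart_mlieBracket_vertLift D hη hθ]
  refine Prod.ext (add_zero _) ?_
  exact (add_zero (christoffelForm D p 0)).trans (christoffelForm_zero D p)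

/-- The covariant derivative of 1-forms commutes with raising the index. -/
theorem sharp_nablaForm (hD : IsLeviCivita (fun x v w ↦ g.inner x v w) D)
    {X : ∀ x : M, TangentSpace 𝓘(ℝ, E) x} (hX : CMDiff ∞ (T% X))
    {θ : ∀ x : M, TangentSpace 𝓘(ℝ, E) x →L[ℝ] ℝ} (hθ : IsSmoothForm θ) (p : Cotangent E M) :
    sharp g p.1 (nablaForm D X θ p.1) = D (fun y ↦ sharp g y (θ y)) p.1 (X p.1) := by
  have hs : CMDiff ∞ (T% (fun y ↦ sharp g y (θ y))) :=
    fun x ↦ contMDiffAt_sharp g fun X hX ↦ hθ X hX x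
  refine (flat_bijective g p.1).1 ?_
  change g.inner p.1 _ = g.inner p.1 _
  rw [inner_sharp]
  refine covector_ext_smooth fun W hW ↦ ?_
  rw [← verPart_mlieBracket_horLift_vertLift hD hX hθ,
    verPart_mlieBracket_horLift_vertLift_apply hD hX hW hθ]
  have h1 := hD.metric _ W p.1 (hs.mdifferentiableAt (by simp)) (hW.mdifferentiableAt (by simp))
    (X p.1)
  simp only [inner_sharp_apply] at h1
  rw [h1]
  ring

end Brackets

/-! ### The horizontal-vertical splitting as linear algebra. -/

section Splitting

variable {E : Type*} [NormedAddCommGroup E] [NormedSpace ℝ E] [FiniteDimensional ℝ E]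
  {M : Type*} [TopologicalSpace M] [ChartedSpace E M] [IsManifold 𝓘(ℝ, E) ∞ M]
  (D : CovariantDerivative 𝓘(ℝ, E) E (TangentSpace 𝓘(ℝ, E) : M → Type _)) (p : Cotangent E M)

/-- `horPart` as a linear map. -/
def horPartₗ : TangentSpace (cotModel E) p →ₗ[ℝ] TangentSpace 𝓘(ℝ, E) p.1 where
  toFun := horPart p
  map_add' _ _ := rfl
  map_smul' _ _ := rfl

theorem christoffelForm_add (v w : TangentSpace 𝓘(ℝ, E) p.1) :
    christoffelForm D p (v + w) = christoffelForm D p v + christoffelForm D p w := by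
  simp [christoffelForm, add_smul, Finset.sum_add_distrib]

theorem christoffelForm_smul (c : ℝ) (v : TangentSpace 𝓘(ℝ, E) p.1) :
    christoffelForm D p (c • v) = c • christoffelForm D p v := by
  simp [christoffelForm, mul_smul, Finset.smul_sum]

/-- `hlift` as a linear map. -/
def hliftₗ : TangentSpace 𝓘(ℝ, E) p.1 →ₗ[ℝ] TangentSpace (cotModel E) p where
  toFun := hlift D p
  map_add' v w := Prod.ext rfl (christoffelForm_add D p v w)
  map_smul' c v := Prod.ext rfl (christoffelForm_smul D p c v)

/-- `vlift` as a linear map. -/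
def vliftₗ : (TangentSpace 𝓘(ℝ, E) p.1 →L[ℝ] ℝ) →ₗ[ℝ] TangentSpace (cotModel E) p where
  toFun := vlift p
  map_add' _ _ := Prod.ext (add_zero _).symm rfl
  map_smul' _ _ := Prod.ext (smul_zero _).symm rfl

theorem ext_horPart_verPart {u w : TangentSpace (cotModel E) p} (h : horPart p u = horPart p w)
    (h' : verPart D p u = verPart D p w) : u = w := by
  rw [← hlift_add_vlift D p u, h, h', hlift_add_vlift]

/-- `verPart` as a linear map. -/
def verPartₗ : TangentSpace (cotModel E) p →ₗ[ℝ] (TangentSpace 𝓘(ℝ, E) p.1 →L[ℝ] ℝ) where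
  toFun := verPart D p
  map_add' u w := by
    have h : christoffelForm D p (horPart p (u + w)) = _ := christoffelForm_add D p _ _
    rw [verPart, h, verPart, verPart]
    exact add_sub_add_comm _ _ _ _
  map_smul' c u := by
    have h : christoffelForm D p (horPart p (c • u)) = _ := christoffelForm_smul D p c _
    rw [verPart, h, verPart]
    exact (smul_sub c _ _).symm

/-- `structJ` as a linear map. -/
def structJₗ : TangentSpace (cotModel E) p →ₗ[ℝ] TangentSpace (cotModel E) p :=
  vliftₗ p ∘ₗ verPartₗ D p - hliftₗ D p ∘ₗ horPartₗ p

theorem structJ_eq : structJ D = fun p : Cotangent E M ↦ ⇑(structJₗ D p) := rfl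

@[simp] theorem horPart_structJ (u : TangentSpace (cotModel E) p) :
    horPart p (structJ D p u) = -horPart p u := by
  change horPartₗ p (vliftₗ p (verPart D p u) - hliftₗ D p (horPart p u)) = _
  rw [map_sub]
  exact zero_sub _

@[simp] theorem verPart_structJ (u : TangentSpace (cotModel E) p) :
    verPart D p (structJ D p u) = verPart D p u := by
  change verPartₗ D p (vliftₗ p (verPart D p u) - hliftₗ D p (horPart p u)) = _
  rw [map_sub]
  change verPart D p (vlift p _) - verPart D p (hlift D p _) = _
  rw [verPart_vlift, verPart_hlift, sub_zero]

theorem structJ_structJ (u : TangentSpace (cotModel E) p) :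
    structJ D p (structJ D p u) = u :=
  ext_horPart_verPart D p (by simp) (by simp)

end Splitting

/-! ### The almost product connection on a general manifold; the Koszul formula. -/

section ProductConnection

variable {E : Type*} [NormedAddCommGroup E] [NormedSpace ℝ E] [FiniteDimensional ℝ E]
  {H : Type*} [TopologicalSpace H] {I : ModelWithCorners ℝ E H}
  {N : Type*} [TopologicalSpace N] [ChartedSpace H N] [IsManifold I ∞ N]
  (D : CovariantDerivative I E (TangentSpace I : N → Type _))
  {J : ∀ x : N, TangentSpace I x →ₗ[ℝ] TangentSpace I x}

/-- Because `J² = 1`, the term `J((∇_X J) Y)` of `S` is `J ∇_X (J Y) - ∇_X Y`, and half of it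
averages `∇_X Y` with `J ∇_X (J Y)`. -/
theorem productConnection_apply (hJ : ∀ x u, J x (J x u) = u)
    (X Y : ∀ x : N, TangentSpace I x) (x : N) :
    productConnection D (fun x ↦ J x) X Y x = (1 / 2 : ℝ) • (D Y x (X x)
        + J x (D (appField (fun x ↦ J x) Y) x (X x))
      - (D (appField (fun x ↦ J x) X) x (J x (Y x)) - J x (D X x (J x (Y x)))
        + J x (D (appField (fun x ↦ J x) X) x (Y x)) - D X x (Y x))) := by
  simp only [productConnection, productTensor, covEnd, nabla, map_sub, hJ]
  change _ - (1 / 2 : ℝ) • ((D (appField (fun x ↦ J x) X) x (J x (Y x)) - J x (D X x (J x (Y x))))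
    + (J x (D (appField (fun x ↦ J x) X) x (Y x)) - D X x (Y x))
    - (J x (D (appField (fun x ↦ J x) Y) x (X x)) - D Y x (X x))) = _
  module

/-- The almost product connection preserves the almost product structure. -/
theorem covEnd_productConnection (hJ : ∀ x u, J x (J x u) = u)
    (X Y : ∀ x : N, TangentSpace I x) :
    covEnd (productConnection D fun x ↦ J x) (fun x ↦ J x) X Y = 0 := by
  funext x
  have h : appField (fun x ↦ J x) (appField (fun x ↦ J x) Y) = Y := funext fun x ↦ hJ x _
  have h' : J x (appField (fun x ↦ J x) Y x) = Y x := hJ x _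
  -- Replacing `Y` by `J Y` permutes the terms exactly as applying `J` to them does.
  rw [covEnd, productConnection_apply D hJ, productConnection_apply D hJ, h, h']
  simp only [map_smul, map_add, map_sub, hJ]
  change _ = (0 : TangentSpace I x)
  rw [← smul_sub]
  refine smul_eq_zero_of_right _ ?_
  simp only [appField]
  abel

/-- On eigenfields with constant eigenvalues `J` leaves the argument of the connection as a scalar.
The lifts are such fields. -/
theorem productConnection_of_eigen (hJ : ∀ x u, J x (J x u) = u) {ε δ : ℝ}
    {X Y : ∀ x : N, TangentSpace I x} {x : N} (hX : MDiffAt (T% X) x) (hY : MDiffAt (T% Y) x)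
    (hXε : ∀ x, J x (X x) = ε • X x) (hYδ : ∀ x, J x (Y x) = δ • Y x) :
    productConnection D (fun x ↦ J x) X Y x = (1 / 2 : ℝ) • (D Y x (X x)
      + δ • J x (D Y x (X x))
      - ((ε * δ - 1) • D X x (Y x) + (ε - δ) • J x (D X x (Y x)))) := by
  have h1 : D (appField (fun x ↦ J x) X) x = ε • D X x := by
    rw [← D.isCovariantDerivativeOnUniv.smul_const ε hX]
    exact congrArg (fun U ↦ D U x) (funext hXε)
  have h2 : D (appField (fun x ↦ J x) Y) x = δ • D Y x := by
    rw [← D.isCovariantDerivativeOnUniv.smul_const δ hY]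
    exact congrArg (fun U ↦ D U x) (funext hYδ)
  rw [productConnection_apply D hJ, h1, h2, hYδ]
  simp only [smul_apply, map_smul]
  module

/-- The Koszul formula. -/
theorem IsLeviCivita.koszul {G : ∀ x : N, TangentSpace I x → TangentSpace I x → ℝ}
    {D : CovariantDerivative I E (TangentSpace I : N → Type _)} (hD : IsLeviCivita G D)
    (hG : ∀ x u w, G x u w = G x w u) (hG' : ∀ x u v w, G x (u - v) w = G x u w - G x v w)
    {X Y Z : ∀ x : N, TangentSpace I x} {x : N} (hX : MDiffAt (T% X) x) (hY : MDiffAt (T% Y) x)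
    (hZ : MDiffAt (T% Z) x) :
    2 * G x (D Y x (X x)) (Z x) =
      d% (fun y ↦ G y (Y y) (Z y)) x (X x) + d% (fun y ↦ G y (X y) (Z y)) x (Y x)
        - d% (fun y ↦ G y (X y) (Y y)) x (Z x)
        + G x (VectorField.mlieBracket I X Y x) (Z x)
        - G x (VectorField.mlieBracket I X Z x) (Y x)
        - G x (VectorField.mlieBracket I Y Z x) (X x) := by
  -- With brackets and derivatives all written through the connection, everything cancels in pairs
  -- except two copies of `G(∇_X Y, Z)`.
  rw [hD.mlieBracket_eq hX hY, hD.mlieBracket_eq hX hZ, hD.mlieBracket_eq hY hZ,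
    hD.metric _ _ x hY hZ, hD.metric _ _ x hX hZ, hD.metric _ _ x hX hY, hG', hG', hG',
    hG x (Y x) (D Z x (X x)), hG x (X x) (D Z x (Y x)), hG x (X x) (D Y x (Z x))]
  ring

end ProductConnection

/-! ### The Cheeger–Gromoll type metric: nondegeneracy and derivatives. -/

section SasakiType

variable {E : Type*} [NormedAddCommGroup E] [NormedSpace ℝ E] [FiniteDimensional ℝ E]
  {M : Type*} [TopologicalSpace M] [ChartedSpace E M] [IsManifold 𝓘(ℝ, E) ∞ M] [T2Space M]
  {g : ContMDiffRiemannianMetric 𝓘(ℝ, E) ∞ E (TangentSpace 𝓘(ℝ, E) : M → Type _)} {f : M → ℝ}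
  {D : CovariantDerivative 𝓘(ℝ, E) E (TangentSpace 𝓘(ℝ, E) : M → Type _)}

theorem cometric_sub_left (x : M) (η θ ζ : TangentSpace 𝓘(ℝ, E) x →L[ℝ] ℝ) :
    cometric g x (η - θ) ζ = cometric g x η ζ - cometric g x θ ζ := rfl

theorem cometric_add_left (x : M) (η θ ζ : TangentSpace 𝓘(ℝ, E) x →L[ℝ] ℝ) :
    cometric g x (η + θ) ζ = cometric g x η ζ + cometric g x θ ζ := rfl

theorem cometric_smul_left (x : M) (c : ℝ) (η ζ : TangentSpace 𝓘(ℝ, E) x →L[ℝ] ℝ) :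
    cometric g x (c • η) ζ = c * cometric g x η ζ := rfl

theorem cgMetric_comm (p : Cotangent E M) (u w : TangentSpace (cotModel E) p) :
    cgMetric g f D p u w = cgMetric g f D p w u := by
  rw [cgMetric, cgMetric, g.symm, cometric_comm p.1 (verPart D p u)]
  ring

theorem cgMetric_sub_left (p : Cotangent E M) (u v w : TangentSpace (cotModel E) p) :
    cgMetric g f D p (u - v) w = cgMetric g f D p u w - cgMetric g f D p v w := by
  have h1 : horPart p (u - v) = horPart p u - horPart p v := rfl
  have h2 : verPart D p (u - v) = verPart D p u - verPart D p v := map_sub (verPartₗ D p) u v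
  rw [cgMetric, cgMetric, cgMetric, h1, h2, cometric_sub_left, cometric_sub_left, map_sub,
    sub_apply]
  ring

theorem cgMetric_hlift_right (p : Cotangent E M) (u : TangentSpace (cotModel E) p)
    (v : TangentSpace 𝓘(ℝ, E) p.1) :
    cgMetric g f D p u (hlift D p v) = f p.1 * g.inner p.1 (horPart p u) v := by
  simp [cgMetric, cometric_comm p.1 _ (0 : TangentSpace 𝓘(ℝ, E) p.1 →L[ℝ] ℝ),
    cometric_zero_left]

theorem cgMetric_vlift_right (p : Cotangent E M) (u : TangentSpace (cotModel E) p)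
    (ζ : TangentSpace 𝓘(ℝ, E) p.1 →L[ℝ] ℝ) :
    cgMetric g f D p u (vlift p ζ) = 1 / alpha g p * (cometric g p.1 (verPart D p u) ζ
      + cometric g p.1 (verPart D p u) p.2 * cometric g p.1 ζ p.2) := by
  simp [cgMetric]

theorem exists_isSmoothForm_eq (g : ContMDiffRiemannianMetric 𝓘(ℝ, E) ∞ E
      (TangentSpace 𝓘(ℝ, E) : M → Type _)) {x : M} (ζ : TangentSpace 𝓘(ℝ, E) x →L[ℝ] ℝ) :
    ∃ θ : ∀ x : M, TangentSpace 𝓘(ℝ, E) x →L[ℝ] ℝ, IsSmoothForm θ ∧ θ x = ζ := by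
  obtain ⟨Z, hZ, hZx⟩ := exists_contMDiff_eq_extend (I := 𝓘(ℝ, E)) (F := E) (sharp g x ζ)
  refine ⟨fun y ↦ g.inner y (Z y), fun X hX ↦ contMDiff_inner g hZ hX, ?_⟩
  have h : Z x = sharp g x ζ := hZx.self_of_nhds.trans (FiberBundle.extend_apply_self E _)
  change g.inner x (Z x) = ζ
  rw [h, inner_sharp]

/-- Testing on a form whose value is the difference `δ` itself gives `g⁻¹(δ, δ) + g⁻¹(δ, p)² = 0`,
hence `δ = 0`. -/
theorem verPart_eq_of_cgMetric_eq {p : Cotangent E M} {u w : TangentSpace (cotModel E) p}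
    (h : ∀ θ : ∀ x : M, TangentSpace 𝓘(ℝ, E) x →L[ℝ] ℝ, IsSmoothForm θ →
      cgMetric g f D p u (vertLift θ p) = cgMetric g f D p w (vertLift θ p)) :
    verPart D p u = verPart D p w := by
  obtain ⟨θ, hθ, hθp⟩ := exists_isSmoothForm_eq g (verPart D p u - verPart D p w)
  have h1 := h θ hθ
  rw [vertLift, cgMetric_vlift_right, cgMetric_vlift_right, hθp] at h1
  have h2 := mul_left_cancel₀ (one_div_ne_zero (alpha_pos p).ne') h1
  set δ := verPart D p u - verPart D p w with hδ
  have h3 : cometric g p.1 δ δ + cometric g p.1 δ p.2 * cometric g p.1 δ p.2 = 0 := by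
    have e1 := cometric_sub_left (g := g) p.1 (verPart D p u) (verPart D p w) δ
    have e2 := cometric_sub_left (g := g) p.1 (verPart D p u) (verPart D p w) p.2
    rw [← hδ] at e1 e2
    linear_combination h2 + e1 + cometric g p.1 δ p.2 * e2
  have h4 : sharp g p.1 δ = 0 := by
    by_contra h0
    have h5 := g.pos p.1 _ h0
    rw [← cometric_eq_inner] at h5
    nlinarith [mul_self_nonneg (cometric g p.1 δ p.2)]
  have h5 := inner_sharp g p.1 δ
  rw [h4, map_zero] at h5
  exact sub_eq_zero.1 h5.symm

theorem horPart_eq_of_cgMetric_eq (hf : ∀ x, 0 < f x) {p : Cotangent E M}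
    {u w : TangentSpace (cotModel E) p}
    (h : ∀ Z : ∀ x : M, TangentSpace 𝓘(ℝ, E) x, CMDiff ∞ (T% Z) →
      cgMetric g f D p u (horLift D Z p) = cgMetric g f D p w (horLift D Z p)) :
    horPart p u = horPart p w := by
  refine (flat_bijective g p.1).1 (covector_ext_smooth fun Z hZ ↦ ?_)
  have h1 := h Z hZ
  rw [horLift, cgMetric_hlift_right, cgMetric_hlift_right] at h1
  exact mul_left_cancel₀ (hf p.1).ne' h1

/-- Obtained by differentiating `α · α⁻¹ = 1`. -/
theorem mvfderiv_inv_alpha (hD : IsLeviCivita (fun x v w ↦ g.inner x v w) D)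
    (q : Cotangent E M) (u : TangentSpace (cotModel E) q) :
    mvfderiv (cotModel E) (fun q ↦ (alpha g q)⁻¹) q u =
      -(2 * cometric g q.1 (verPart D q u) q.2) * ((alpha g q)⁻¹ * (alpha g q)⁻¹) := by
  have h1 : MDifferentiableAt (cotModel E) 𝓘(ℝ, ℝ) (alpha g) q :=
    contMDiff_alpha.mdifferentiableAt (by simp)
  have h2 : MDifferentiableAt (cotModel E) 𝓘(ℝ, ℝ) (fun q ↦ (alpha g q)⁻¹) q :=
    (differentiableAt_inv (alpha_pos (g := g) q).ne').comp_mdifferentiableAt h1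
  have h3 : (alpha g * fun q ↦ (alpha g q)⁻¹) = fun _ ↦ 1 :=
    funext fun q ↦ mul_inv_cancel₀ (alpha_pos (g := g) q).ne'
  have h4 := mvfderiv_mul h1 h2
  rw [h3, mvfderiv_const] at h4
  have h5 := congrArg (fun A : TangentSpace (cotModel E) q →L[ℝ] ℝ ↦ A u) h4
  simp only [add_apply, smul_apply, smul_eq_mul, zero_apply] at h5
  rw [mvfderiv_alpha hD] at h5
  have h6 := mul_inv_cancel₀ (alpha_pos (g := g) q).ne'
  linear_combination (mvfderiv (cotModel E) (fun q ↦ (alpha g q)⁻¹) q u) * (-h6)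
    - (alpha g q)⁻¹ * h5

theorem contMDiff_sharp {η : ∀ x : M, TangentSpace 𝓘(ℝ, E) x →L[ℝ] ℝ} (hη : IsSmoothForm η) :
    CMDiff ∞ (T% (fun x ↦ sharp g x (η x))) :=
  fun x ↦ contMDiffAt_sharp g fun X hX ↦ hη X hX x

/-- The derivative of the inner product of vertical lifts. -/
theorem mvfderiv_cgMetric_vertLift (hD : IsLeviCivita (fun x v w ↦ g.inner x v w) D)
    {η θ : ∀ x : M, TangentSpace 𝓘(ℝ, E) x →L[ℝ] ℝ} (hη : IsSmoothForm η) (hθ : IsSmoothForm θ)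
    (p : Cotangent E M) (u : TangentSpace (cotModel E) p) :
    mvfderiv (cotModel E) (fun q ↦ cgMetric g f D q (vertLift η q) (vertLift θ q)) p u =
      (alpha g p)⁻¹ *
        (mvfderiv 𝓘(ℝ, E) (fun x ↦ g.inner x (sharp g x (η x)) (sharp g x (θ x))) p.1
            (horPart p u)
          + cometric g p.1 (η p.1) p.2
            * mvfderiv (cotModel E) (evalField fun x ↦ sharp g x (θ x)) p u
          + cometric g p.1 (θ p.1) p.2
            * mvfderiv (cotModel E) (evalField fun x ↦ sharp g x (η x)) p u)
      - 2 * cometric g p.1 (verPart D p u) p.2 * ((alpha g p)⁻¹ * (alpha g p)⁻¹)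
        * (cometric g p.1 (η p.1) (θ p.1)
          + cometric g p.1 (η p.1) p.2 * cometric g p.1 (θ p.1) p.2) := by
  have hS {η : ∀ x : M, TangentSpace 𝓘(ℝ, E) x →L[ℝ] ℝ} (hη : IsSmoothForm η) :
      MDifferentiableAt (cotModel E) 𝓘(ℝ, ℝ) (evalField fun x ↦ sharp g x (η x)) p :=
    mdifferentiableAt_evalField ((contMDiff_sharp hη).mdifferentiableAt (by simp))
  have h0 : MDifferentiableAt 𝓘(ℝ, E) 𝓘(ℝ, ℝ)
      (fun x ↦ g.inner x (sharp g x (η x)) (sharp g x (θ x))) p.1 :=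
    (contMDiff_inner g (contMDiff_sharp hη) (contMDiff_sharp hθ)).mdifferentiableAt (by simp)
  have h1 : MDifferentiableAt (cotModel E) 𝓘(ℝ, ℝ) (fun q ↦ (alpha g q)⁻¹) p :=
    (differentiableAt_inv (alpha_pos (g := g) p).ne').comp_mdifferentiableAt
      (contMDiff_alpha.mdifferentiableAt (by simp))
  have h2 (η : ∀ x : M, TangentSpace 𝓘(ℝ, E) x →L[ℝ] ℝ) (q : Cotangent E M) :
      evalField (fun x ↦ sharp g x (η x)) q = cometric g q.1 (η q.1) q.2 :=
    cometric_comm (g := g) q.1 q.2 (η q.1)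
  -- The inner product is built from `α⁻¹`, a function pulled back from `M`, and two evaluation
  -- functions, whose derivatives are all known.
  have h3 : (fun q ↦ cgMetric g f D q (vertLift η q) (vertLift θ q)) =
      (fun q ↦ (alpha g q)⁻¹) *
        ((fun q : Cotangent E M ↦ g.inner q.1 (sharp g q.1 (η q.1)) (sharp g q.1 (θ q.1))) +
          evalField (fun x ↦ sharp g x (η x)) * evalField (fun x ↦ sharp g x (θ x))) := by
    funext q
    simp only [Pi.mul_apply, Pi.add_apply, h2]
    rw [vertLift, vertLift, cgMetric_vlift_vlift, cometric_eq_inner, one_div]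
  have h4 := mdifferentiableAt_comp_proj (q := p) h0
  have h5 := (hS hη).mul (hS hθ)
  rw [h3, mvfderiv_mul h1 (h4.add h5), mvfderiv_add h4 h5, mvfderiv_mul (hS hη) (hS hθ)]
  simp only [add_apply, smul_apply, smul_eq_mul, Pi.add_apply, Pi.mul_apply, h2]
  rw [mvfderiv_inv_alpha hD, mvfderiv_comp_proj h0, ← cometric_eq_inner]
  ring

end SasakiType

/-! ### Components of the Levi-Civita connection on the cotangent bundle: vertical parts. -/

section LeviCivita

variable {E : Type*} [NormedAddCommGroup E] [NormedSpace ℝ E] [FiniteDimensional ℝ E]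
  {M : Type*} [TopologicalSpace M] [ChartedSpace E M] [IsManifold 𝓘(ℝ, E) ∞ M] [T2Space M]
  {g : ContMDiffRiemannianMetric 𝓘(ℝ, E) ∞ E (TangentSpace 𝓘(ℝ, E) : M → Type _)} {f : M → ℝ}
  {D : CovariantDerivative 𝓘(ℝ, E) E (TangentSpace 𝓘(ℝ, E) : M → Type _)}
  {Dt : CovariantDerivative (cotModel E) (E × (E →L[ℝ] ℝ))
      (TangentSpace (cotModel E) : Cotangent E M → Type _)}

theorem cgMetric_zero_left (p : Cotangent E M) (w : TangentSpace (cotModel E) p) :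
    cgMetric g f D p 0 w = 0 := by
  rw [← sub_self (0 : TangentSpace (cotModel E) p), cgMetric_sub_left, sub_self]

/-- As `g⁻¹(p, p) = α - 1`, the bracket in the metric is `α g⁻¹(η, p)`, and the factor `1 / α`
cancels. -/
theorem cgMetric_liouville_right (p : Cotangent E M) (η : TangentSpace 𝓘(ℝ, E) p.1 →L[ℝ] ℝ) :
    cgMetric g f D p (vlift p η) (liouville p) = cometric g p.1 η p.2 := by
  have h1 := (alpha_pos (g := g) p).ne'
  have h2 : cometric g p.1 p.2 p.2 = alpha g p - 1 := (add_sub_cancel_left _ _).symm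
  rw [liouville, cgMetric_vlift_right, verPart_vlift, h2]
  field_simp
  ring

theorem mvfderiv_cgMetric_vertLift_vertLift (hD : IsLeviCivita (fun x v w ↦ g.inner x v w) D)
    {η θ ν : ∀ x : M, TangentSpace 𝓘(ℝ, E) x →L[ℝ] ℝ} (hη : IsSmoothForm η) (hθ : IsSmoothForm θ)
    (p : Cotangent E M) :
    mvfderiv (cotModel E) (fun q ↦ cgMetric g f D q (vertLift η q) (vertLift θ q)) p
        (vertLift ν p) =
      (alpha g p)⁻¹ * (cometric g p.1 (η p.1) p.2 * cometric g p.1 (ν p.1) (θ p.1)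
          + cometric g p.1 (θ p.1) p.2 * cometric g p.1 (ν p.1) (η p.1))
      - 2 * cometric g p.1 (ν p.1) p.2 * ((alpha g p)⁻¹ * (alpha g p)⁻¹)
        * (cometric g p.1 (η p.1) (θ p.1)
          + cometric g p.1 (η p.1) p.2 * cometric g p.1 (θ p.1) p.2) := by
  have hS {η : ∀ x : M, TangentSpace 𝓘(ℝ, E) x →L[ℝ] ℝ} (hη : IsSmoothForm η) :
      mvfderiv (cotModel E) (evalField fun x ↦ sharp g x (η x)) p (vlift p (ν p.1)) =
        cometric g p.1 (ν p.1) (η p.1) :=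
    mvfderiv_evalField_vlift D ((contMDiff_sharp hη).mdifferentiableAt (by simp)) _
  rw [mvfderiv_cgMetric_vertLift hD hη hθ]
  rw [vertLift, horPart_vlift, verPart_vlift, map_zero, hS hη, hS hθ, zero_add]

/-- `α` is horizontally constant and `∇` commutes with raising the index, so the horizontal
derivative obeys the Leibniz rule with `∇_X η` and `∇_X θ`. -/
theorem mvfderiv_cgMetric_vertLift_horLift (hD : IsLeviCivita (fun x v w ↦ g.inner x v w) D)
    {η θ : ∀ x : M, TangentSpace 𝓘(ℝ, E) x →L[ℝ] ℝ} (hη : IsSmoothForm η) (hθ : IsSmoothForm θ)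
    {X : ∀ x : M, TangentSpace 𝓘(ℝ, E) x} (hX : CMDiff ∞ (T% X)) (p : Cotangent E M) :
    mvfderiv (cotModel E) (fun q ↦ cgMetric g f D q (vertLift η q) (vertLift θ q)) p
        (horLift D X p) =
      cgMetric g f D p (vlift p (nablaForm D X η p.1)) (vertLift θ p)
        + cgMetric g f D p (vlift p (nablaForm D X θ p.1)) (vertLift η p) := by
  have hs {η : ∀ x : M, TangentSpace 𝓘(ℝ, E) x →L[ℝ] ℝ} (hη : IsSmoothForm η) :
      MDiffAt (T% (fun x ↦ sharp g x (η x))) p.1 :=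
    (contMDiff_sharp hη).mdifferentiableAt (by simp)
  have hS {η : ∀ x : M, TangentSpace 𝓘(ℝ, E) x →L[ℝ] ℝ} (hη : IsSmoothForm η) :
      mvfderiv (cotModel E) (evalField fun x ↦ sharp g x (η x)) p (hlift D p (X p.1)) =
        cometric g p.1 (nablaForm D X η p.1) p.2 := by
    rw [mvfderiv_evalField_hlift D (hs hη), ← sharp_nablaForm hD hX hη]
    exact cometric_comm (g := g) p.1 p.2 _
  have hm : mvfderiv 𝓘(ℝ, E) (fun x ↦ g.inner x (sharp g x (η x)) (sharp g x (θ x))) p.1 (X p.1) =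
      cometric g p.1 (nablaForm D X η p.1) (θ p.1)
        + cometric g p.1 (nablaForm D X θ p.1) (η p.1) := by
    refine (hD.metric _ _ p.1 (hs hη) (hs hθ) (X p.1)).trans ?_
    rw [← sharp_nablaForm hD hX hη, ← sharp_nablaForm hD hX hθ, cometric_eq_inner,
      cometric_eq_inner, g.symm p.1 (sharp g p.1 (η p.1))]
  rw [mvfderiv_cgMetric_vertLift hD hη hθ]
  rw [horLift, horPart_hlift, verPart_hlift, hS hη, hS hθ, hm, cometric_zero_left, vertLift,
    vertLift, cgMetric_vlift_right, cgMetric_vlift_right, verPart_vlift, verPart_vlift, one_div]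
  ring

theorem cgMetric_vertLift_horLift (η : ∀ x : M, TangentSpace 𝓘(ℝ, E) x →L[ℝ] ℝ)
    (X : ∀ x : M, TangentSpace 𝓘(ℝ, E) x) :
    (fun p ↦ cgMetric g f D p (vertLift η p) (horLift D X p)) = fun _ ↦ 0 :=
  funext fun p ↦ cgMetric_vlift_hlift g f D p _ _

theorem cgMetric_horLift_vertLift (η : ∀ x : M, TangentSpace 𝓘(ℝ, E) x →L[ℝ] ℝ)
    (X : ∀ x : M, TangentSpace 𝓘(ℝ, E) x) :
    (fun p ↦ cgMetric g f D p (horLift D X p) (vertLift η p)) = fun _ ↦ 0 :=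
  funext fun p ↦ (cgMetric_comm p _ _).trans (cgMetric_vlift_hlift g f D p _ _)

theorem mvfderiv_cgMetric_horLift (hf : ContMDiff 𝓘(ℝ, E) 𝓘(ℝ, ℝ) ∞ f)
    {X Y : ∀ x : M, TangentSpace 𝓘(ℝ, E) x} (hX : CMDiff ∞ (T% X)) (hY : CMDiff ∞ (T% Y))
    (p : Cotangent E M) (u : TangentSpace (cotModel E) p) :
    mvfderiv (cotModel E) (fun q ↦ cgMetric g f D q (horLift D X q) (horLift D Y q)) p u =
      f p.1 * mvfderiv 𝓘(ℝ, E) (fun x ↦ g.inner x (X x) (Y x)) p.1 (horPart p u)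
        + mvfderiv 𝓘(ℝ, E) f p.1 (horPart p u) * g.inner p.1 (X p.1) (Y p.1) := by
  have h1 : MDifferentiableAt 𝓘(ℝ, E) 𝓘(ℝ, ℝ) f p.1 := hf.mdifferentiableAt (by simp)
  have h2 : MDifferentiableAt 𝓘(ℝ, E) 𝓘(ℝ, ℝ) (fun x ↦ g.inner x (X x) (Y x)) p.1 :=
    (contMDiff_inner g hX hY).mdifferentiableAt (by simp)
  have h3 : (fun q ↦ cgMetric g f D q (horLift D X q) (horLift D Y q)) =
      fun q : Cotangent E M ↦ (f * fun x ↦ g.inner x (X x) (Y x)) q.1 :=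
    funext fun q ↦ cgMetric_hlift_hlift g f D q _ _
  rw [h3, mvfderiv_comp_proj (h1.mul h2), mvfderiv_mul h1 h2]
  simp only [add_apply, smul_apply, smul_eq_mul]
  ring

/-- Vertical part of the connection on vertical lifts. -/
theorem verPart_nabla_vertLift_vertLift (hD : IsLeviCivita (fun x v w ↦ g.inner x v w) D)
    (hDt : IsLeviCivita (cgMetric g f D) Dt)
    {η θ : ∀ x : M, TangentSpace 𝓘(ℝ, E) x →L[ℝ] ℝ} (hη : IsSmoothForm η) (hθ : IsSmoothForm θ)
    (p : Cotangent E M) :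
    verPart D p (Dt (vertLift θ) p (vertLift η p)) =
      -(1 / alpha g p) • (cometric g p.1 (η p.1) p.2 • θ p.1 + cometric g p.1 (θ p.1) p.2 • η p.1)
        + ((alpha g p + 1) / alpha g p
          * cgMetric g f D p (vertLift η p) (vertLift θ p)) • p.2
        - (1 / alpha g p * cometric g p.1 (η p.1) p.2 * cometric g p.1 (θ p.1) p.2) • p.2 := by
  set κ := -(1 / alpha g p) •
      (cometric g p.1 (η p.1) p.2 • θ p.1 + cometric g p.1 (θ p.1) p.2 • η p.1)
        + ((alpha g p + 1) / alpha g p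
          * cgMetric g f D p (vertLift η p) (vertLift θ p)) • p.2
        - (1 / alpha g p * cometric g p.1 (η p.1) p.2 * cometric g p.1 (θ p.1) p.2) • p.2 with hκ
  rw [← verPart_vlift D p κ]
  refine verPart_eq_of_cgMetric_eq (g := g) (f := f) fun ζ hζ ↦ ?_
  -- Vertical lifts commute, so only the three derivative terms of the Koszul formula remain.
  have h1 := hDt.koszul cgMetric_comm cgMetric_sub_left (mdifferentiableAt_vertLift hη D p)
    (mdifferentiableAt_vertLift hθ D p) (mdifferentiableAt_vertLift hζ D p)
  have h0 := cgMetric_zero_left (g := g) (f := f) (D := D) p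
  rw [mlieBracket_vertLift D hη hθ, mlieBracket_vertLift D hη hζ, mlieBracket_vertLift D hθ hζ,
    h0, h0, h0, mvfderiv_cgMetric_vertLift_vertLift hD hη hθ,
    mvfderiv_cgMetric_vertLift_vertLift hD hη hζ, mvfderiv_cgMetric_vertLift_vertLift hD hθ hζ] at h1
  have h2 := alpha_pos (g := g) p
  -- Pairing the candidate `κ` with `p` produces `g⁻¹(p, p)`; expressing it through `α` makes both
  -- sides rational in `α` and comparable.
  have h3 : cometric g p.1 p.2 p.2 = alpha g p - 1 := (add_sub_cancel_left _ _).symm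
  have h4 (ζ : TangentSpace 𝓘(ℝ, E) p.1 →L[ℝ] ℝ) : cometric g p.1 κ ζ =
      -(1 / alpha g p) * (cometric g p.1 (η p.1) p.2 * cometric g p.1 (θ p.1) ζ
        + cometric g p.1 (θ p.1) p.2 * cometric g p.1 (η p.1) ζ)
      + ((alpha g p + 1) / alpha g p * (1 / alpha g p * (cometric g p.1 (η p.1) (θ p.1)
        + cometric g p.1 (η p.1) p.2 * cometric g p.1 (θ p.1) p.2))) * cometric g p.1 p.2 ζ
      - (1 / alpha g p * cometric g p.1 (η p.1) p.2 * cometric g p.1 (θ p.1) p.2)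
        * cometric g p.1 p.2 ζ := by
    rw [hκ, cometric_sub_left, cometric_add_left, cometric_smul_left, cometric_add_left,
      cometric_smul_left, cometric_smul_left, cometric_smul_left, cometric_smul_left, vertLift,
      vertLift, cgMetric_vlift_vlift]
  refine mul_left_cancel₀ (two_ne_zero (α := ℝ)) (h1.trans ?_)
  have h5 : cgMetric g f D p (vlift p κ) (vertLift ζ p) = 1 / alpha g p * (cometric g p.1 κ (ζ p.1)
      + cometric g p.1 κ p.2 * cometric g p.1 (ζ p.1) p.2) := by
    rw [vertLift, cgMetric_vlift_vlift]
  rw [h5, h4, h4, h3, cometric_comm p.1 (ζ p.1) (η p.1), cometric_comm p.1 (ζ p.1) (θ p.1),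
    cometric_comm p.1 (θ p.1) (η p.1), cometric_comm p.1 p.2 (ζ p.1)]
  field_simp
  ring

/-- In the Koszul formula for `^Vθ, ^HX, ^Vζ` the only nonzero derivative is `^HX` of the product of
`^Vθ` and `^Vζ`. By `mvfderiv_cgMetric_vertLift_horLift` it cancels against the brackets `[^Vθ,
^HX]` and `[^HX, ^Vζ]`. -/
theorem verPart_nabla_vertLift_horLift (hD : IsLeviCivita (fun x v w ↦ g.inner x v w) D)
    (hDt : IsLeviCivita (cgMetric g f D) Dt) {X : ∀ x : M, TangentSpace 𝓘(ℝ, E) x}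
    (hX : CMDiff ∞ (T% X)) {θ : ∀ x : M, TangentSpace 𝓘(ℝ, E) x →L[ℝ] ℝ} (hθ : IsSmoothForm θ)
    (p : Cotangent E M) :
    verPart D p (Dt (horLift D X) p (vertLift θ p)) = 0 := by
  rw [← map_zero (verPartₗ D p)]
  refine verPart_eq_of_cgMetric_eq (g := g) (f := f) fun ζ hζ ↦ ?_
  have h1 := hDt.koszul cgMetric_comm cgMetric_sub_left (mdifferentiableAt_vertLift hθ D p)
    (mdifferentiableAt_horLift hD hX p) (mdifferentiableAt_vertLift hζ D p)
  have h0 := cgMetric_zero_left (g := g) (f := f) (D := D) p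
  have h2 (η ζ : ∀ x : M, TangentSpace 𝓘(ℝ, E) x →L[ℝ] ℝ) (hζ : IsSmoothForm ζ) :
      cgMetric g f D p (VectorField.mlieBracket (cotModel E) (horLift D X) (vertLift ζ) p)
        (vertLift η p) = cgMetric g f D p (vlift p (nablaForm D X ζ p.1)) (vertLift η p) := by
    rw [vertLift, cgMetric_vlift_right, cgMetric_vlift_right,
      verPart_mlieBracket_horLift_vertLift hD hX hζ, verPart_vlift]
  have h3 : cgMetric g f D p
      (VectorField.mlieBracket (cotModel E) (vertLift θ) (horLift D X) p) (vertLift ζ p) =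
      -cgMetric g f D p (vlift p (nablaForm D X θ p.1)) (vertLift ζ p) := by
    rw [VectorField.mlieBracket_swap_apply, ← h2 ζ θ hθ, neg_eq_zero_sub, cgMetric_sub_left, h0,
      zero_sub]
  rw [cgMetric_horLift_vertLift, cgMetric_vertLift_horLift, mvfderiv_const,
    mvfderiv_cgMetric_vertLift_horLift hD hθ hζ hX, mlieBracket_vertLift D hθ hζ, h0, h2 θ ζ hζ,
    h3, zero_apply, zero_apply] at h1
  rw [h0]
  linarith

end LeviCivita

/-! ### Horizontal parts, and the product connection on lifts. -/

section ProductConnectionLifts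

variable {E : Type*} [NormedAddCommGroup E] [NormedSpace ℝ E] [FiniteDimensional ℝ E]
  {M : Type*} [TopologicalSpace M] [ChartedSpace E M] [IsManifold 𝓘(ℝ, E) ∞ M] [T2Space M]
  {g : ContMDiffRiemannianMetric 𝓘(ℝ, E) ∞ E (TangentSpace 𝓘(ℝ, E) : M → Type _)} {f : M → ℝ}
  {D : CovariantDerivative 𝓘(ℝ, E) E (TangentSpace 𝓘(ℝ, E) : M → Type _)}
  {Dt : CovariantDerivative (cotModel E) (E × (E →L[ℝ] ℝ))
      (TangentSpace (cotModel E) : Cotangent E M → Type _)}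

theorem inner_nabla_koszul (hD : IsLeviCivita (fun x v w ↦ g.inner x v w) D)
    {X Y Z : ∀ x : M, TangentSpace 𝓘(ℝ, E) x} (hX : CMDiff ∞ (T% X)) (hY : CMDiff ∞ (T% Y))
    (hZ : CMDiff ∞ (T% Z)) (x : M) :
    2 * g.inner x (nabla D X Y x) (Z x) =
      d% (fun y ↦ g.inner y (Y y) (Z y)) x (X x) + d% (fun y ↦ g.inner y (X y) (Z y)) x (Y x)
        - d% (fun y ↦ g.inner y (X y) (Y y)) x (Z x)
        + g.inner x (VectorField.mlieBracket 𝓘(ℝ, E) X Y x) (Z x)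
        - g.inner x (VectorField.mlieBracket 𝓘(ℝ, E) X Z x) (Y x)
        - g.inner x (VectorField.mlieBracket 𝓘(ℝ, E) Y Z x) (X x) :=
  hD.koszul (fun x u w ↦ g.symm x u w)
    (fun x u v w ↦ by simp only [map_sub, sub_apply])
    (hX.mdifferentiableAt (by simp)) (hY.mdifferentiableAt (by simp))
    (hZ.mdifferentiableAt (by simp))

theorem inner_tensorA (X Y : ∀ x : M, TangentSpace 𝓘(ℝ, E) x) (x : M)
    (w : TangentSpace 𝓘(ℝ, E) x) :
    g.inner x (tensorA g f X Y x) w = 1 / (2 * f x) * (d% f x (X x) * g.inner x (Y x) w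
      + d% f x (Y x) * g.inner x (X x) w - g.inner x (X x) (Y x) * d% f x w) := by
  have h : g.inner x (grad g f x) w = d% f x w := inner_sharp_apply g x _ w
  simp only [tensorA, map_smul, map_add, map_sub, smul_apply, add_apply, sub_apply, smul_eq_mul, h]

/-- As for a conformal change: the Koszul expression on `T*M` is `f` times that of `g` plus the
three derivatives of `f`, and these sum to `2 f g(A(X, Y), Z)`. -/
theorem horPart_nabla_horLift_horLift (hf : ContMDiff 𝓘(ℝ, E) 𝓘(ℝ, ℝ) ∞ f) (hf0 : ∀ x, 0 < f x)
    (hD : IsLeviCivita (fun x v w ↦ g.inner x v w) D) (hDt : IsLeviCivita (cgMetric g f D) Dt)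
    {X Y : ∀ x : M, TangentSpace 𝓘(ℝ, E) x} (hX : CMDiff ∞ (T% X)) (hY : CMDiff ∞ (T% Y))
    (p : Cotangent E M) :
    horPart p (Dt (horLift D Y) p (horLift D X p)) = nabla D X Y p.1 + tensorA g f X Y p.1 := by
  rw [← horPart_hlift D p (nabla D X Y p.1 + tensorA g f X Y p.1)]
  refine horPart_eq_of_cgMetric_eq (g := g) (D := D) hf0 fun Z hZ ↦ ?_
  have h1 := hDt.koszul cgMetric_comm cgMetric_sub_left (mdifferentiableAt_horLift hD hX p)
    (mdifferentiableAt_horLift hD hY p) (mdifferentiableAt_horLift hD hZ p)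
  have h2 := inner_nabla_koszul hD hX hY hZ p.1
  have hB (X Y Z : ∀ x : M, TangentSpace 𝓘(ℝ, E) x) (hX : CMDiff ∞ (T% X))
      (hY : CMDiff ∞ (T% Y)) :
      cgMetric g f D p (VectorField.mlieBracket (cotModel E) (horLift D X) (horLift D Y) p)
        (horLift D Z p) = f p.1 * g.inner p.1 (VectorField.mlieBracket 𝓘(ℝ, E) X Y p.1) (Z p.1) := by
    rw [horLift, cgMetric_hlift_right, horPart_mlieBracket_horLift hD hX hY]
  have hd {X Y : ∀ x : M, TangentSpace 𝓘(ℝ, E) x} (hX : CMDiff ∞ (T% X)) (hY : CMDiff ∞ (T% Y))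
      (Z : ∀ x : M, TangentSpace 𝓘(ℝ, E) x) :
      mvfderiv (cotModel E) (fun q ↦ cgMetric g f D q (horLift D X q) (horLift D Y q)) p
        (horLift D Z p) = f p.1 * mvfderiv 𝓘(ℝ, E) (fun x ↦ g.inner x (X x) (Y x)) p.1 (Z p.1)
        + mvfderiv 𝓘(ℝ, E) f p.1 (Z p.1) * g.inner p.1 (X p.1) (Y p.1) :=
    mvfderiv_cgMetric_horLift hf hX hY p _
  rw [hd hY hZ, hd hX hZ, hd hX hY, hB X Y Z hX hY, hB X Z Y hX hZ, hB Y Z X hY hZ] at h1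
  refine mul_left_cancel₀ (two_ne_zero (α := ℝ)) (h1.trans ?_)
  have h3 := (hf0 p.1).ne'
  rw [horLift, cgMetric_hlift_hlift, map_add, add_apply, inner_tensorA]
  field_simp
  linear_combination (-f p.1) * h2

/-- Locality in the first argument, needed because `curvVector` uses coordinate fields while the
bracket formulas use global ones. -/
theorem curvature_congr (hD : IsLeviCivita (fun x v w ↦ g.inner x v w) D)
    {X X' Y W : ∀ x : M, TangentSpace 𝓘(ℝ, E) x} {x : M} (hX : CMDiff ∞ (T% X))
    (hW : CMDiff ∞ (T% W)) (h : X =ᶠ[𝓝 x] X') : curvature D X Y W x = curvature D X' Y W x := by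
  have h1 : D (nabla D X W) x = D (nabla D X' W) x :=
    D_congr ((contMDiff_nabla hD hX hW).mdifferentiableAt (by simp))
      (h.mono fun y hy ↦ congrArg (D W y) hy)
  have h2 : VectorField.mlieBracket 𝓘(ℝ, E) X Y x = VectorField.mlieBracket 𝓘(ℝ, E) X' Y x :=
    h.mlieBracket_vectorField_eq Filter.EventuallyEq.rfl
  simp only [curvature]
  rw [nabla, nabla, nabla, nabla, nabla, nabla, h1, h2, h.self_of_nhds]

theorem inner_curvVector (p : Cotangent E M) (Y W : ∀ x : M, TangentSpace 𝓘(ℝ, E) x)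
    (s : Fin (Module.finrank ℝ E)) :
    g.inner p.1 (curvVector g D p Y W) (coordField p.1 s p.1) =
      p.2 (curvature D (coordField p.1 s) Y W p.1) := by
  have hc (j) : coordForm p.1 j (coordField p.1 s p.1) = if s = j then 1 else 0 := by
    rw [coordField_self]
    change (Module.finBasis ℝ E).coord j (Module.finBasis ℝ E s) = _
    simp [Finsupp.single_apply]
  simp [curvVector, inner_sharp_apply, hc]

/-- In the Koszul formula for `^HY, ^Vη, ^HZ` the product of the horizontal lifts is pulled back
from `M`, so `^Vη` kills it, and the mixed brackets are vertical. Only `[^HY, ^HZ]` paired with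
`^Vη` survives, and that is curvature. -/
theorem horPart_nabla_horLift_vertLift (hf : ContMDiff 𝓘(ℝ, E) 𝓘(ℝ, ℝ) ∞ f) (hf0 : ∀ x, 0 < f x)
    (hD : IsLeviCivita (fun x v w ↦ g.inner x v w) D) (hDt : IsLeviCivita (cgMetric g f D) Dt)
    {Y : ∀ x : M, TangentSpace 𝓘(ℝ, E) x} (hY : CMDiff ∞ (T% Y))
    {η : ∀ x : M, TangentSpace 𝓘(ℝ, E) x →L[ℝ] ℝ} (hη : IsSmoothForm η) (p : Cotangent E M) :
    horPart p (Dt (vertLift η) p (horLift D Y p)) =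
      (1 / (2 * f p.1 * alpha g p)) • curvVector g D p Y (fun x ↦ sharp g x (η x)) := by
  obtain ⟨Z, hZ, hZp⟩ := exists_contMDiff_eq_coordField (E := E) p.1
  refine (flat_bijective g p.1).1 (covector_ext fun s ↦ ?_)
  have h0 := cgMetric_zero_left (g := g) (f := f) (D := D) p
  have h1 := hDt.koszul cgMetric_comm cgMetric_sub_left (mdifferentiableAt_horLift hD hY p)
    (mdifferentiableAt_vertLift hη D p) (mdifferentiableAt_horLift hD (hZ s) p)
  have h2 : mvfderiv (cotModel E) (fun q ↦ cgMetric g f D q (horLift D Y q) (horLift D (Z s) q)) p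
      (vertLift η p) = 0 := by
    rw [mvfderiv_cgMetric_horLift hf hY (hZ s), vertLift, horPart_vlift, map_zero, map_zero]
    ring
  have h3 : cgMetric g f D p
      (VectorField.mlieBracket (cotModel E) (horLift D Y) (vertLift η) p) (horLift D (Z s) p) = 0 := by
    rw [horLift, cgMetric_hlift_right, horPart_mlieBracket_horLift_vertLift hD hY hη, map_zero,
      zero_apply, mul_zero]
  have h4 : cgMetric g f D p
      (VectorField.mlieBracket (cotModel E) (vertLift η) (horLift D (Z s)) p) (horLift D Y p) = 0 := by
    rw [VectorField.mlieBracket_swap_apply, neg_eq_zero_sub, cgMetric_sub_left, h0, horLift,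
      cgMetric_hlift_right, horPart_mlieBracket_horLift_vertLift hD (hZ s) hη, map_zero,
      zero_apply, mul_zero, sub_zero]
  have h5 : cgMetric g f D p
      (VectorField.mlieBracket (cotModel E) (horLift D Y) (horLift D (Z s)) p) (vertLift η p) =
      -(1 / alpha g p * p.2 (curvature D (Z s) Y (fun x ↦ sharp g x (η x)) p.1)) := by
    -- The swap puts `Z` in the first slot of `R`, as in `curvVector`. The second summand of the
    -- metric drops out because the vertical part of the bracket is orthogonal to `p`.
    rw [VectorField.mlieBracket_swap_apply, neg_eq_zero_sub, cgMetric_sub_left, h0, vertLift,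
      cgMetric_vlift_right, cometric_verPart_mlieBracket_horLift hD (hZ s) hY, cometric,
      verPart_mlieBracket_horLift hD (hZ s) hY (contMDiff_sharp hη)]
    ring
  have h6 (u : TangentSpace (cotModel E) p) : cgMetric g f D p u (horLift D (Z s) p) =
      f p.1 * g.inner p.1 (horPart p u) (Z s p.1) := cgMetric_hlift_right p u _
  rw [cgMetric_vertLift_horLift, cgMetric_horLift_vertLift, mvfderiv_const, h2, h3, h4, h5,
    zero_apply, zero_apply, h6] at h1
  rw [curvature_congr hD (hZ s) (contMDiff_sharp hη) (hZp.mono fun y hy ↦ hy s),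
    ← inner_curvVector (g := g), hZp.self_of_nhds s] at h1
  have hf' := (hf0 p.1).ne'
  have ha := (alpha_pos (g := g) p).ne'
  change g.inner p.1 _ _ = g.inner p.1 _ _
  rw [map_smul, smul_apply, smul_eq_mul]
  field_simp
  field_simp at h1
  linear_combination h1

theorem structJ_horLift (X : ∀ x : M, TangentSpace 𝓘(ℝ, E) x) (p : Cotangent E M) :
    structJₗ D p (horLift D X p) = (-1 : ℝ) • horLift D X p :=
  (structJ_hlift D p _).trans (neg_one_smul ℝ _).symm

theorem structJ_vertLift (D : CovariantDerivative 𝓘(ℝ, E) E (TangentSpace 𝓘(ℝ, E) : M → Type _))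
    (η : ∀ x : M, TangentSpace 𝓘(ℝ, E) x →L[ℝ] ℝ) (p : Cotangent E M) :
    structJₗ D p (vertLift η p) = (1 : ℝ) • vertLift η p :=
  (structJ_vlift D p _).trans (one_smul ℝ _).symm

/-- `J` is `-1` on horizontal vectors. For signs `ε`, `δ` the result is zero if `δ = 1`; if `δ = -1`
the weights are `1` and `1 + ε`. -/
theorem horPart_productConnection {ε δ : ℝ}
    {U V : ∀ q : Cotangent E M, TangentSpace (cotModel E) q} {p : Cotangent E M}
    (hU : MDifferentiableAt (cotModel E) (cotModel E).tangent
      (fun q ↦ (⟨q, U q⟩ : TangentBundle (cotModel E) (Cotangent E M))) p)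
    (hV : MDifferentiableAt (cotModel E) (cotModel E).tangent
      (fun q ↦ (⟨q, V q⟩ : TangentBundle (cotModel E) (Cotangent E M))) p)
    (hUε : ∀ q, structJₗ D q (U q) = ε • U q) (hVδ : ∀ q, structJₗ D q (V q) = δ • V q) :
    horPart p (productConnection Dt (structJ D) U V p) =
      ((1 - δ) / 2) • horPart p (Dt V p (U p))
        + ((1 - δ) * (1 + ε) / 2) • horPart p (Dt U p (V p)) := by
  rw [structJ_eq, productConnection_of_eigen Dt (structJ_structJ D) hU hV hUε hVδ]
  have h0 (u : TangentSpace (cotModel E) p) : horPart p u = horPartₗ p u := rfl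
  have h (u : TangentSpace (cotModel E) p) : horPartₗ p (structJₗ D p u) = -horPartₗ p u :=
    horPart_structJ D p u
  simp only [h0, map_smul, map_add, map_sub, h]
  module

/-- The vertical counterpart, where `J` is `1`: zero if `δ = -1`, weights `1` and `1 - ε` if `δ =
1`. -/
theorem verPart_productConnection {ε δ : ℝ}
    {U V : ∀ q : Cotangent E M, TangentSpace (cotModel E) q} {p : Cotangent E M}
    (hU : MDifferentiableAt (cotModel E) (cotModel E).tangent
      (fun q ↦ (⟨q, U q⟩ : TangentBundle (cotModel E) (Cotangent E M))) p)
    (hV : MDifferentiableAt (cotModel E) (cotModel E).tangent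
      (fun q ↦ (⟨q, V q⟩ : TangentBundle (cotModel E) (Cotangent E M))) p)
    (hUε : ∀ q, structJₗ D q (U q) = ε • U q) (hVδ : ∀ q, structJₗ D q (V q) = δ • V q) :
    verPart D p (productConnection Dt (structJ D) U V p) =
      ((1 + δ) / 2) • verPart D p (Dt V p (U p))
        + ((1 + δ) * (1 - ε) / 2) • verPart D p (Dt U p (V p)) := by
  rw [structJ_eq, productConnection_of_eigen Dt (structJ_structJ D) hU hV hUε hVδ]
  have h0 (u : TangentSpace (cotModel E) p) : verPart D p u = verPartₗ D p u := rfl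
  have h (u : TangentSpace (cotModel E) p) : verPartₗ D p (structJₗ D p u) = verPartₗ D p u :=
    verPart_structJ D p u
  simp only [h0, map_smul, map_add, map_sub, h]
  module

theorem vertLift_combination (η θ : ∀ x : M, TangentSpace 𝓘(ℝ, E) x →L[ℝ] ℝ) (p : Cotangent E M)
    (a b c d e : ℝ) :
    a • (b • vertLift η p + c • vertLift θ p) + d • liouville p - e • liouville p =
      vlift p (a • (b • η p.1 + c • θ p.1) + d • p.2 - e • p.2) := by
  change a • (b • vliftₗ p (η p.1) + c • vliftₗ p (θ p.1)) + d • vliftₗ p p.2 - e • vliftₗ p p.2 =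
    vliftₗ p _
  simp only [map_smul, map_add, map_sub]

end ProductConnectionLifts

end CheegerGromoll

end

/-! ### The theorem. -/

open CheegerGromoll in
theorem mainTheorem9
    {E : Type*} [NormedAddCommGroup E] [NormedSpace ℝ E] [FiniteDimensional ℝ E]
    {M : Type*} [TopologicalSpace M] [T2Space M] [SecondCountableTopology M]
    [ChartedSpace E M] [IsManifold 𝓘(ℝ, E) ∞ M]
    (g : ContMDiffRiemannianMetric 𝓘(ℝ, E) ∞ E (TangentSpace 𝓘(ℝ, E) : M → Type _))
    (f : M → ℝ) (hf : ContMDiff 𝓘(ℝ, E) 𝓘(ℝ, ℝ) ∞ f) (hf0 : ∀ x, 0 < f x)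
    (D : CovariantDerivative 𝓘(ℝ, E) E (TangentSpace 𝓘(ℝ, E) : M → Type _))
    (hD : IsLeviCivita (fun x v w ↦ g.inner x v w) D)
    (Dt : CovariantDerivative (cotModel E) (E × (E →L[ℝ] ℝ))
      (TangentSpace (cotModel E) : Cotangent E M → Type _))
    (hDt : IsLeviCivita (cgMetric g f D) Dt) :
    (∀ X Y : ∀ p : Cotangent E M, TangentSpace (cotModel E) p,
      covEnd (productConnection Dt (structJ D)) (structJ D) X Y = 0) ∧
    ∀ (X Y : ∀ x : M, TangentSpace 𝓘(ℝ, E) x) (η θ : ∀ x : M, TangentSpace 𝓘(ℝ, E) x →L[ℝ] ℝ),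
      CMDiff ∞ (T% X) → CMDiff ∞ (T% Y) →
      ContMDiff 𝓘(ℝ, E) (cotModel E) ∞ (fun x ↦ (⟨x, η x⟩ : Cotangent E M)) →
      ContMDiff 𝓘(ℝ, E) (cotModel E) ∞ (fun x ↦ (⟨x, θ x⟩ : Cotangent E M)) →
      ∀ p : Cotangent E M,
        productConnection Dt (structJ D) (horLift D X) (horLift D Y) p
            = horLift D (nabla D X Y) p + horLift D (tensorA g f X Y) p ∧
        productConnection Dt (structJ D) (horLift D X) (vertLift θ) p
            = vertLift (nablaForm D X θ) p ∧
        productConnection Dt (structJ D) (vertLift η) (horLift D Y) p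
            = (3 / (2 * f p.1 * alpha g p)) •
                hlift D p (curvVector g D p Y (fun x ↦ sharp g x (η x))) ∧
        productConnection Dt (structJ D) (vertLift η) (vertLift θ) p
            = -(1 / alpha g p) •
                (cgMetric g f D p (vertLift η p) (liouville p) • vertLift θ p
                  + cgMetric g f D p (vertLift θ p) (liouville p) • vertLift η p)
              + ((alpha g p + 1) / alpha g p
                  * cgMetric g f D p (vertLift η p) (vertLift θ p)) • liouville p
              - (1 / alpha g p * cgMetric g f D p (vertLift η p) (liouville p)
                  * cgMetric g f D p (vertLift θ p) (liouville p)) • liouville p := by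
  refine ⟨covEnd_productConnection (J := structJₗ D) Dt (structJ_structJ D), fun X Y η θ hX hY hη' hθ' p ↦ ?_⟩
  have hη : IsSmoothForm η := fun X hX ↦ contMDiff_form_apply hη' hX
  have hθ : IsSmoothForm θ := fun X hX ↦ contMDiff_form_apply hθ' hX
  have hHX := mdifferentiableAt_horLift hD hX p
  have hHY := mdifferentiableAt_horLift hD hY p
  have hVη := mdifferentiableAt_vertLift hη D p
  have hVθ := mdifferentiableAt_vertLift hθ D p
  refine ⟨?_, ?_, ?_, ?_⟩
  · change _ = hliftₗ D p (nabla D X Y p.1) + hliftₗ D p (tensorA g f X Y p.1)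
    rw [← map_add]
    refine ext_horPart_verPart D p ?_ ?_
    · rw [horPart_productConnection hHX hHY (structJ_horLift X) (structJ_horLift Y),
        horPart_nabla_horLift_horLift hf hf0 hD hDt hX hY p]
      norm_num
      rfl
    · rw [verPart_productConnection hHX hHY (structJ_horLift X) (structJ_horLift Y)]
      refine Eq.trans ?_ (verPart_hlift D p _).symm
      norm_num
  -- By torsion-freeness `ver ∇~_{HX} Vθ` is the vertical part of the bracket, since `ver ∇~_{Vθ} HX
  -- = 0`; the latter also removes the term of weight `2`.
  · have h1 := hDt.mlieBracket_eq hHX hVθ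
    have h2 : verPart D p (VectorField.mlieBracket (cotModel E) (horLift D X) (vertLift θ) p) =
        verPart D p (Dt (vertLift θ) p (horLift D X p))
          - verPart D p (Dt (horLift D X) p (vertLift θ p)) :=
      (congrArg (verPart D p) h1).trans (map_sub (verPartₗ D p) _ _)
    rw [verPart_mlieBracket_horLift_vertLift hD hX hθ,
      verPart_nabla_vertLift_horLift hD hDt hX hθ, sub_zero] at h2
    refine ext_horPart_verPart D p ?_ ?_
    · rw [horPart_productConnection hHX hVθ (structJ_horLift X) (structJ_vertLift D θ)]
      norm_num
      rfl
    · rw [verPart_productConnection hHX hVθ (structJ_horLift X) (structJ_vertLift D θ),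
        verPart_nabla_vertLift_horLift hD hDt hX hθ, ← h2, vertLift, verPart_vlift]
      norm_num
  · have h1 := hDt.mlieBracket_eq hHY hVη
    have h2 : horPart p (VectorField.mlieBracket (cotModel E) (horLift D Y) (vertLift η) p) =
        horPart p (Dt (vertLift η) p (horLift D Y p))
          - horPart p (Dt (horLift D Y) p (vertLift η p)) :=
      (congrArg (horPart p) h1).trans (map_sub (horPartₗ p) _ _)
    rw [horPart_mlieBracket_horLift_vertLift hD hY hη] at h2
    -- The two mixed derivatives share their horizontal part, so the weights `1` and `2` add up to
    -- the factor `3`.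
    have h3 := sub_eq_zero.1 h2.symm
    have h4 := horPart_nabla_horLift_vertLift hf hf0 hD hDt hY hη p
    change _ = (_ : ℝ) • hliftₗ D p _
    rw [← map_smul]
    refine ext_horPart_verPart D p ?_ ?_
    · rw [horPart_productConnection hVη hHY (structJ_vertLift D η) (structJ_horLift Y), ← h3, h4]
      change _ = (_ : ℝ) • _
      rw [smul_smul, smul_smul, ← add_smul]
      congr 1
      have ha := (alpha_pos (g := g) p).ne'
      have hf' := (hf0 p.1).ne'
      field_simp
      norm_num
    · rw [verPart_productConnection hVη hHY (structJ_vertLift D η) (structJ_horLift Y)]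
      refine Eq.trans ?_ (verPart_hlift D p _).symm
      norm_num
  · have hl (η : ∀ x : M, TangentSpace 𝓘(ℝ, E) x →L[ℝ] ℝ) :
        cgMetric g f D p (vertLift η p) (liouville p) = cometric g p.1 (η p.1) p.2 :=
      cgMetric_liouville_right p _
    rw [hl, hl]
    rw [vertLift_combination]
    refine ext_horPart_verPart D p ?_ ?_
    · rw [horPart_productConnection hVη hVθ (structJ_vertLift D η) (structJ_vertLift D θ)]
      norm_num
    · rw [verPart_productConnection hVη hVθ (structJ_vertLift D η) (structJ_vertLift D θ),
        verPart_nabla_vertLift_vertLift hD hDt hη hθ]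
      refine Eq.trans ?_ (verPart_vlift D p _).symm
      norm_num
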